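/- In the Counting Orthogonal Vectors problem ($\#\mathsf{OV}$) one is given $n\ge 1$, $d\ge 0$ and vectors $u_1,\dots,u_n,v_1,\dots,v_n\in\{0,1\}^d$, and must output the number of pairs $(i,j)\in\{1,\dots,n\}^2$ with $\langle u_i,v_j\rangle=0$, where the inner product is taken over $\mathbb Z$. The problem $\#\mathsf{OV}$ can be solved deterministically in time $\tilde O(n\cdot 1.26^d)$. That is, there are a single deterministic random access machine program and constants $C,k$ such that, for all $n\ge 1$, all $d\ge 0$ and all inputs $u_1,\dots,u_n,v_1,\dots,v_n\in\{0,1\}^d$, the program halts with the correct count after time at most $$C\cdot n\cdot 1.26^d\cdot\bigl(1+\log(n\cdot 1.26^d)\bigr)^k .$$ Time is measured in the logarithmic cost model: registers and memory cells hold natural numbers, the instructions are loading a constant, addition, truncated subtraction, indirect read and write, and tests for zero, and each executed instruction costs one plus the total bit length of the numbers and memory addresses on which it operates. The input is given as $n$ and $d$ in two registers and the $2nd$ bits of the vectors in consecutive memory cells; all other registers and cells are initially $0$. -/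

import Mathlib

/-! ### A random access machine with logarithmic cost

The machine has registers `r₀, r₁, r₂, …` (a program names only finitely many of them) and a memory
with cells `0, 1, 2, …`; each register and each cell holds a natural number. The instruction set is
the classical one: load a constant, addition, (truncated) subtraction, indirect read, indirect
write, and control flow by testing a register for zero. Every executed instruction is charged one
unit plus the bit lengths of all the numbers and memory addresses on which it operates. -/

namespace RAM

/-- The contents of the registers and of the memory. -/
structure State where
  reg : ℕ → ℕ
  mem : ℕ → ℕ

/-- The state after writing `x` into register `i`. -/
def State.setReg (s : State) (i x : ℕ) : State :=
  ⟨Function.update s.reg i x, s.mem⟩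

/-- The state after writing `x` into memory cell `a`. -/
def State.setMem (s : State) (a x : ℕ) : State :=
  ⟨s.reg, Function.update s.mem a x⟩

/-- Programs. A program is a finite object; the numbers `i`, `j`, `k` (register names) and `c`
(constants) are fixed in the program text and so do not depend on the input. -/
inductive Program where
  /-- do nothing -/
  | skip : Program
  /-- `rᵢ := c` -/
  | const (i c : ℕ) : Program
  /-- `rᵢ := rⱼ + rₖ` -/
  | add (i j k : ℕ) : Program
  /-- `rᵢ := max (rⱼ - rₖ) 0` -/
  | sub (i j k : ℕ) : Program
  /-- `rᵢ := mem[rⱼ]` -/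
  | load (i j : ℕ) : Program
  /-- `mem[rᵢ] := rⱼ` -/
  | store (i j : ℕ) : Program
  /-- first `p`, then `q` -/
  | seq (p q : Program) : Program
  /-- if `rᵢ ≠ 0` then `p` else `q` -/
  | cond (i : ℕ) (p q : Program) : Program
  /-- while `rᵢ ≠ 0` do `p` -/
  | loop (i : ℕ) (p : Program) : Program

/-- `Runs p s s' t`: started in state `s`, the program `p` halts in state `s'`, and the total
(logarithmic) cost of the execution is `t`. `Nat.size x` is the bit length of `x`. -/
inductive Runs : Program → State → State → ℕ → Prop where
  | skip (s : State) : Runs .skip s s 1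
  | const (i c : ℕ) (s : State) : Runs (.const i c) s (s.setReg i c) (1 + c.size)
  | add (i j k : ℕ) (s : State) :
      Runs (.add i j k) s (s.setReg i (s.reg j + s.reg k))
        (1 + (s.reg j).size + (s.reg k).size)
  | sub (i j k : ℕ) (s : State) :
      Runs (.sub i j k) s (s.setReg i (s.reg j - s.reg k))
        (1 + (s.reg j).size + (s.reg k).size)
  | load (i j : ℕ) (s : State) :
      Runs (.load i j) s (s.setReg i (s.mem (s.reg j)))
        (1 + (s.reg j).size + (s.mem (s.reg j)).size)
  | store (i j : ℕ) (s : State) :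
      Runs (.store i j) s (s.setMem (s.reg i) (s.reg j))
        (1 + (s.reg i).size + (s.reg j).size)
  | seq {p q : Program} {s s' s'' : State} {t t' : ℕ} :
      Runs p s s' t → Runs q s' s'' t' → Runs (.seq p q) s s'' (t + t')
  | cond_true {i : ℕ} {p q : Program} {s s' : State} {t : ℕ} :
      s.reg i ≠ 0 → Runs p s s' t → Runs (.cond i p q) s s' (1 + (s.reg i).size + t)
  | cond_false {i : ℕ} {p q : Program} {s s' : State} {t : ℕ} :
      s.reg i = 0 → Runs q s s' t → Runs (.cond i p q) s s' (1 + (s.reg i).size + t)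
  | loop_done {i : ℕ} {p : Program} {s : State} :
      s.reg i = 0 → Runs (.loop i p) s s (1 + (s.reg i).size)
  | loop_step {i : ℕ} {p : Program} {s s' s'' : State} {t t' : ℕ} :
      s.reg i ≠ 0 → Runs p s s' t → Runs (.loop i p) s' s'' t' →
      Runs (.loop i p) s s'' (1 + (s.reg i).size + t + t')

/-- The machine is deterministic: final state and cost are functions of program and start state. -/
theorem Runs.deterministic {p : Program} {s s₁ s₂ : State} {t₁ t₂ : ℕ}
    (h₁ : Runs p s s₁ t₁) (h₂ : Runs p s s₂ t₂) : s₁ = s₂ ∧ t₁ = t₂ := by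
  induction h₁ generalizing s₂ t₂ with
  | skip | const | add | sub | load | store => cases h₂; exact ⟨rfl, rfl⟩
  | seq _ _ ih ih' =>
    cases h₂ with
    | seq a b =>
      obtain ⟨rfl, rfl⟩ := ih a
      obtain ⟨rfl, rfl⟩ := ih' b
      exact ⟨rfl, rfl⟩
  | cond_true h _ ih =>
    cases h₂ with
    | cond_true _ a => obtain ⟨rfl, rfl⟩ := ih a; exact ⟨rfl, rfl⟩
    | cond_false h' _ => exact absurd h' h
  | cond_false h _ ih =>
    cases h₂ with
    | cond_true h' _ => exact absurd h h'
    | cond_false _ a => obtain ⟨rfl, rfl⟩ := ih a; exact ⟨rfl, rfl⟩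
  | loop_done h =>
    cases h₂ with
    | loop_done _ => exact ⟨rfl, rfl⟩
    | loop_step h' _ _ => exact absurd h h'
  | loop_step h _ _ ih ih' =>
    cases h₂ with
    | loop_done h' => exact absurd h' h
    | loop_step _ a b =>
      obtain ⟨rfl, rfl⟩ := ih a
      obtain ⟨rfl, rfl⟩ := ih' b
      exact ⟨rfl, rfl⟩

end RAM

/-! ### Counting orthogonal vectors -/

namespace OrthogonalVectors

/-- The number of pairs `(i, j)` with `⟨uᵢ, vⱼ⟩ = 0`, the inner product being taken over `ℤ`. -/
def count {n d : ℕ} (u v : Fin n → Fin d → Bool) : ℕ :=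
  (Finset.univ.filter fun p : Fin n × Fin n =>
    ∑ l : Fin d, ((u p.1 l).toNat : ℤ) * ((v p.2 l).toNat : ℤ) = 0).card

/-- The entry in row `a / d` and column `a % d` of an `n × d` table of bits written row by row, and
`0` beyond the end of the table. -/
def entry {n d : ℕ} (u : Fin n → Fin d → Bool) (a : ℕ) : ℕ :=
  if h : a < n * d then
    (u ⟨a / d, Nat.div_lt_of_lt_mul (by rwa [Nat.mul_comm] at h)⟩
      ⟨a % d, Nat.mod_lt a (Nat.pos_of_ne_zero (by rintro rfl; simp at h))⟩).toNat
  else 0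

/-- The start state on input `u₁, …, uₙ, v₁, …, vₙ ∈ {0,1}ᵈ`: register `0` holds `n`, register `1`
holds `d`, the memory cells `0, …, nd - 1` hold the bits of `u₁, …, uₙ`, the cells
`nd, …, 2nd - 1` those of `v₁, …, vₙ`, one bit per cell; all other registers and cells are `0`. -/
def input {n d : ℕ} (u v : Fin n → Fin d → Bool) : RAM.State where
  reg i := if i = 0 then n else if i = 1 then d else 0
  mem a := if a < n * d then entry u a else entry v (a - n * d)

end OrthogonalVectors

/-!
Cut the vectors into blocks of a constant number `κ` of coordinates. The matrix that indicates
whether two blocks are disjoint has size `2 ^ κ`, but it is a product of two matrices with entries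
`0`, `1` and `-1` whose rows have at most `β ^ κ` nonzero entries, for every `β` with `2 < β ^ 3`
and suitable `κ`. To see this, split a block once more. Disjoint sets `X` and `Y` of `b` coordinates
are recognised by `∑ S ⊆ Xᶜ, [S = Y]`, by `∑ S ⊆ Yᶜ, [S = X]`, and by `∑ S ⊆ X ∩ Y, (-1) ^ |S|`. The
logarithms of the numbers of keys add up to `b` over the three tests, for `X` as well as for `Y`, so
the tests can be chosen such that both sides spend about `b / 3` per part on average.

Taking products over the blocks, every vector turns into about `β ^ d` signed keys, and the number
of orthogonal pairs is the number of pairs of equal keys, counted with signs.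
-/

namespace OrthogonalVectors

/-! ### Balancing two sums greedily -/

section Balancing

variable {R : Type*} [CommRing R] [LinearOrder R] [IsStrictOrderedRing R]

theorem max_add_zero_sq_le (a x : R) :
    (max (a + x) 0) ^ 2 ≤ (max a 0) ^ 2 + 2 * max a 0 * x + x ^ 2 := by
  rcases le_total a 0 with h | h <;> rcases le_total (a + x) 0 with h' | h' <;>
    simp only [max_eq_left, max_eq_right, h, h'] <;> nlinarith

/-- The squared distance to the quadrant `{a, b ≤ 0}` grows by at most `r` in each step if the step
is chosen to point back towards the quadrant, as in Blackwell's approachability theorem. -/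
theorem exists_max_sum_zero_sq_add_le {ι : Type*} (m : ℕ) (x y : Fin m → ι → R) (r : R)
    (hr : ∀ j o, x j o ^ 2 + y j o ^ 2 ≤ r)
    (hback : ∀ j p q, 0 ≤ p → 0 ≤ q → ∃ o, p * x j o + q * y j o ≤ 0) :
    ∃ o : Fin m → ι,
      (max (∑ j, x j (o j)) 0) ^ 2 + (max (∑ j, y j (o j)) 0) ^ 2 ≤ m * r := by
  induction m with
  | zero => exact ⟨fun j => j.elim0, by simp⟩
  | succ m ih =>
    obtain ⟨o, ho⟩ := ih (fun j => x j.castSucc) (fun j => y j.castSucc) (fun j => hr _)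
      (fun j => hback _)
    set a := ∑ j : Fin m, x j.castSucc (o j)
    set b := ∑ j : Fin m, y j.castSucc (o j)
    obtain ⟨e, he⟩ := hback (Fin.last m) (max a 0) (max b 0) (le_max_right _ _) (le_max_right _ _)
    refine ⟨Fin.snoc o e, ?_⟩
    simp only [Fin.sum_univ_castSucc, Fin.snoc_castSucc, Fin.snoc_last, Nat.cast_succ]
    linarith [max_add_zero_sq_le a (x (Fin.last m) e), max_add_zero_sq_le b (y (Fin.last m) e),
      hr (Fin.last m) e]

end Balancing

/-! ### Three tests for disjointness -/

/-- The ways to recognise disjoint sets `X` and `Y` by enumerating one family of sets for `X` and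
another for `Y`: the subsets of `Xᶜ` against `Y` alone, `X` alone against the subsets of `Yᶜ`, or
the subsets of `X` against the subsets of `Y`. The name refers to the family of `X`. -/
inductive Mode where
  | compl
  | self
  | subsets

namespace Mode

variable {α : Type*}

/-- The mode that exchanges the roles of the two sets. -/
def dual : Mode → Mode
  | compl => self
  | self => compl
  | subsets => subsets

/-- The family of sets enumerated for `X`; the other set uses the dual mode. -/
def family [Fintype α] [DecidableEq α] : Mode → Finset α → Finset (Finset α)
  | compl, X => Xᶜ.powerset
  | self, X => {X}
  | subsets, X => X.powerset

/-- The binary logarithm of the size of the family of a set of size `a` in a universe of size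
`b`. -/
def cost : Mode → ℕ → ℕ → ℕ
  | compl, b, a => b - a
  | self, _, _ => 0
  | subsets, _, a => a

/-- The sign with which a common member of the two families counts. -/
def sign : Mode → Finset α → ℤ
  | compl, _ => 1
  | self, _ => 1
  | subsets, S => (-1) ^ S.card

theorem isUnit_sign (o : Mode) (S : Finset α) : IsUnit (o.sign S) := by
  cases o
  · exact isUnit_one
  · exact isUnit_one
  · exact isUnit_one.neg.pow _

variable [Fintype α] [DecidableEq α]

theorem card_family (o : Mode) (X : Finset α) :
    (o.family X).card = 2 ^ o.cost (Fintype.card α) X.card := by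
  cases o <;> simp [family, cost, Finset.card_powerset, Finset.card_compl]

theorem sum_sign (o : Mode) (X Y : Finset α) :
    ∑ S ∈ o.family X ∩ o.dual.family Y, o.sign S = if Disjoint X Y then 1 else 0 := by
  cases o with
  | compl =>
    simp only [family, dual, sign, Finset.inter_singleton, Finset.mem_powerset,
      Finset.subset_compl_iff_disjoint_left]
    split_ifs <;> simp
  | self =>
    simp only [family, dual, sign, Finset.singleton_inter, Finset.mem_powerset,
      Finset.subset_compl_iff_disjoint_right]
    split_ifs <;> simp
  | subsets =>
    have hinter : X.powerset ∩ Y.powerset = (X ∩ Y).powerset := by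
      ext S
      simp only [Finset.mem_inter, Finset.mem_powerset, Finset.subset_inter_iff]
    simp only [family, dual, sign, hinter, Finset.sum_powerset_neg_one_pow_card,
      Finset.disjoint_iff_inter_eq_empty]

theorem cost_le (o : Mode) {b a : ℕ} (ha : a ≤ b) : o.cost b a ≤ b := by
  cases o <;> simp [cost, ha]

theorem exists_weighted_cost_le {b a c : ℕ} (ha : a ≤ b) (hc : c ≤ b) (p q : ℤ) :
    ∃ o : Mode, p * (3 * o.cost b a - b) + q * (3 * o.dual.cost b c - b) ≤ 0 := by
  by_contra! h
  have hcompl := h compl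
  have hself := h self
  have hsubsets := h subsets
  simp only [cost, dual, Nat.cast_sub ha, Nat.cast_sub hc, Nat.cast_zero] at hcompl hself hsubsets
  -- the three left-hand sides add up to zero
  linarith

end Mode

/-- With `8 * s ^ 2` blocks the bound `8 * s ^ 2 * (8 * b ^ 2)` that the greedy choice gives is a
perfect square. -/
theorem exists_modes (b s : ℕ) (a c : Fin (8 * s ^ 2) → ℕ) (ha : ∀ j, a j ≤ b)
    (hc : ∀ j, c j ≤ b) :
    ∃ o : Fin (8 * s ^ 2) → Mode,
      3 * ∑ j, (o j).cost b (a j) ≤ 8 * s ^ 2 * b + 8 * s * b ∧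
        3 * ∑ j, (o j).dual.cost b (c j) ≤ 8 * s ^ 2 * b + 8 * s * b := by
  have hsq (o : Mode) {w : ℕ} (hw : w ≤ b) : (3 * (o.cost b w : ℤ) - b) ^ 2 ≤ 4 * (b : ℤ) ^ 2 := by
    have := o.cost_le hw
    calc (3 * (o.cost b w : ℤ) - b) ^ 2 ≤ (2 * (b : ℤ)) ^ 2 := sq_le_sq' (by omega) (by omega)
      _ = 4 * (b : ℤ) ^ 2 := by ring
  obtain ⟨o, ho⟩ := exists_max_sum_zero_sq_add_le (8 * s ^ 2)
    (fun j (o : Mode) => 3 * (o.cost b (a j) : ℤ) - b)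
    (fun j (o : Mode) => 3 * (o.dual.cost b (c j) : ℤ) - b) (8 * (b : ℤ) ^ 2)
    (fun j o => by linarith [hsq o (ha j), hsq o.dual (hc j)])
    (fun j p q _ _ => Mode.exists_weighted_cost_le (ha j) (hc j) p q)
  have hbound {x y : ℤ} (h : (max x 0) ^ 2 + (max y 0) ^ 2 ≤ (8 * s * b) ^ 2) : x ≤ 8 * s * b :=
    (le_max_left x 0).trans
      (abs_le_of_sq_le_sq' (by linarith [sq_nonneg (max y 0)]) (by positivity)).2
  have hr : ((8 * s ^ 2 : ℕ) : ℤ) * (8 * (b : ℤ) ^ 2) = (8 * s * b) ^ 2 := by push_cast; ring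
  rw [hr] at ho
  have hleft := hbound ho
  have hright := hbound ((add_comm _ _).trans_le ho)
  simp only [Finset.sum_sub_distrib, ← Finset.mul_sum, Finset.sum_const, Finset.card_univ,
    Fintype.card_fin, nsmul_eq_mul] at hleft hright
  exact ⟨o, by zify; push_cast at hleft; linarith, by zify; push_cast at hright; linarith⟩

/-! ### Keys -/

section Keys

variable {α J T P : Type*} [Fintype α] [DecidableEq α] [Fintype J] [DecidableEq J] [Fintype T]
  [DecidableEq P]

/-- The keys of a family of sets `X j` in the mode assignment `f`: a parameter `e t` together with
a choice of one set from each of the families that the modes `f (e t) j` prescribe for `X j`. -/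
def keys (e : T → P) (f : P → J → Mode) (X : J → Finset α) : Finset (P × (J → Finset α)) :=
  Finset.univ.biUnion fun t =>
    (Fintype.piFinset fun j => (f (e t) j).family (X j)).image (Prod.mk (e t))

/-- The sign with which a common key counts. -/
def keySign (f : P → J → Mode) (k : P × (J → Finset α)) : ℤ :=
  ∏ j, (f k.1 j).sign (k.2 j)

theorem mem_keys {e : T → P} {f : P → J → Mode} {X : J → Finset α} {k : P × (J → Finset α)} :
    k ∈ keys e f X ↔ k.1 ∈ Set.range e ∧ ∀ j, k.2 j ∈ (f k.1 j).family (X j) := by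
  obtain ⟨p, S⟩ := k
  simp only [keys, Finset.mem_biUnion, Finset.mem_univ, true_and, Finset.mem_image,
    Fintype.mem_piFinset, Set.mem_range, Prod.mk.injEq]
  constructor
  · rintro ⟨t, S, hS, rfl, rfl⟩
    exact ⟨⟨t, rfl⟩, hS⟩
  · rintro ⟨⟨t, rfl⟩, hS⟩
    exact ⟨t, S, hS, rfl, rfl⟩

theorem card_keys_le {e : T → P} {f : P → J → Mode} {X : J → Finset α} {N : ℕ}
    (hN : ∀ t, ∑ j, (f (e t) j).cost (Fintype.card α) (X j).card ≤ N) :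
    (keys e f X).card ≤ Fintype.card T * 2 ^ N := by
  refine Finset.card_biUnion_le_card_mul _ _ _ fun t _ => Finset.card_image_le.trans ?_
  simp only [Fintype.card_piFinset, Mode.card_family, Finset.prod_pow_eq_pow_sum]
  exact Nat.pow_le_pow_right two_pos (hN t)

theorem sum_keySign {W : Type*} [Fintype W] [DecidableEq W] (f : W × W → J → Mode) (w w' : W)
    (X Y : J → Finset α) :
    ∑ k ∈ keys (w, ·) f X ∩ keys (·, w') (fun p j => (f p j).dual) Y, keySign f k =
      if ∀ j, Disjoint (X j) (Y j) then 1 else 0 := by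
  have hcommon : keys (w, ·) f X ∩ keys (·, w') (fun p j => (f p j).dual) Y =
      (Fintype.piFinset fun j => (f (w, w') j).family (X j) ∩
        (f (w, w') j).dual.family (Y j)).image (Prod.mk (w, w')) := by
    ext ⟨⟨t, t'⟩, S⟩
    simp only [Finset.mem_inter, mem_keys, Set.mem_range, Finset.mem_image, Fintype.mem_piFinset,
      Prod.mk.injEq]
    constructor
    · rintro ⟨⟨⟨_, rfl, rfl⟩, hX⟩, ⟨_, -, rfl⟩, hY⟩
      exact ⟨S, fun j => ⟨hX j, hY j⟩, ⟨rfl, rfl⟩, rfl⟩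
    · rintro ⟨S, hS, ⟨rfl, rfl⟩, rfl⟩
      exact ⟨⟨⟨_, rfl, rfl⟩, fun j => (hS j).1⟩, ⟨_, rfl, rfl⟩, fun j => (hS j).2⟩
  rw [hcommon, Finset.sum_image (Prod.mk_right_injective _).injOn]
  simp only [keySign, ← Finset.prod_univ_sum, Mode.sum_sign, Fintype.prod_ite_zero,
    Finset.prod_const_one]

end Keys

theorem isUnit_keySign {α J P : Type*} [Fintype J] (f : P → J → Mode)
    (k : P × (J → Finset α)) : IsUnit (keySign f k) :=
  Finset.univ.prod_induction _ IsUnit (fun _ _ => IsUnit.mul) isUnit_one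
    fun _ _ => Mode.isUnit_sign _ _

/-- The sizes of the blocks of a vector. -/
def weights {m b : ℕ} (X : Fin m → Finset (Fin b)) (j : Fin m) : Fin (b + 1) :=
  ⟨(X j).card, Nat.lt_succ_of_le (card_finset_fin_le (X j))⟩

theorem exists_card_keys_le (b s : ℕ) :
    ∃ f : (Fin (8 * s ^ 2) → Fin (b + 1)) × (Fin (8 * s ^ 2) → Fin (b + 1)) →
        Fin (8 * s ^ 2) → Mode,
      ∀ X : Fin (8 * s ^ 2) → Finset (Fin b),
        (keys (weights X, ·) f X).card ≤
            (b + 1) ^ (8 * s ^ 2) * 2 ^ ((8 * s ^ 2 * b + 8 * s * b) / 3) ∧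
          (keys (·, weights X) (fun p j => (f p j).dual) X).card ≤
            (b + 1) ^ (8 * s ^ 2) * 2 ^ ((8 * s ^ 2 * b + 8 * s * b) / 3) := by
  have h (p : (Fin (8 * s ^ 2) → Fin (b + 1)) × (Fin (8 * s ^ 2) → Fin (b + 1))) :=
    exists_modes b s (fun j => p.1 j) (fun j => p.2 j) (fun j => (p.1 j).is_le)
      (fun j => (p.2 j).is_le)
  choose f hleft hright using h
  have hcard : Fintype.card (Fin (8 * s ^ 2) → Fin (b + 1)) = (b + 1) ^ (8 * s ^ 2) := by simp
  refine ⟨f, fun X => ⟨(card_keys_le fun t => ?_).trans_eq (by rw [hcard]),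
    (card_keys_le fun t => ?_).trans_eq (by rw [hcard])⟩⟩ <;> rw [Fintype.card_fin]
  · exact (Nat.le_div_iff_mul_le three_pos).2 ((mul_comm _ _).trans_le (hleft (weights X, t)))
  · exact (Nat.le_div_iff_mul_le three_pos).2 ((mul_comm _ _).trans_le (hright (t, weights X)))

theorem exists_succ_pow_le_two_pow (k : ℕ) : ∃ b : ℕ, 0 < b ∧ ((b : ℝ) + 1) ^ k ≤ 2 ^ b := by
  have hlim := tendsto_pow_const_div_const_pow_of_one_lt k (one_lt_two (α := ℝ))
  obtain ⟨b, hb, hb0⟩ := (((Filter.tendsto_add_atTop_iff_nat 1).2 hlim).eventually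
    (gt_mem_nhds (half_pos one_pos))).and (Filter.eventually_gt_atTop 0) |>.exists
  refine ⟨b, hb0, ?_⟩
  rw [div_lt_iff₀ (by positivity), pow_succ' 2 b, ← mul_assoc, div_mul_cancel₀ _ two_ne_zero,
    one_mul] at hb
  exact_mod_cast hb.le

theorem keyBound_le_pow {β : ℝ} (hβ : 0 ≤ β) {b s : ℕ} (hs : 4 ≤ (β ^ 3 / 2) ^ s)
    (hb : ((b : ℝ) + 1) ^ (3 * s) ≤ 2 ^ b) :
    ((b : ℝ) + 1) ^ (8 * s ^ 2) * 2 ^ ((8 * s ^ 2 * b + 8 * s * b) / 3) ≤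
      β ^ (8 * s ^ 2 * b) := by
  set N := (8 * s ^ 2 * b + 8 * s * b) / 3
  refine le_of_pow_le_pow_left₀ three_ne_zero (by positivity) ?_
  calc (((b : ℝ) + 1) ^ (8 * s ^ 2) * 2 ^ N) ^ 3
      = (((b : ℝ) + 1) ^ (3 * s)) ^ (8 * s) * 2 ^ (3 * N) := by ring
    _ ≤ (2 ^ b) ^ (8 * s) * 2 ^ (8 * s ^ 2 * b + 8 * s * b) := by
        gcongr
        · exact one_le_two
        · exact Nat.mul_div_le _ _
    _ = (2 ^ 2) ^ (8 * s * b) * 2 ^ (8 * s ^ 2 * b) := by rw [← pow_mul 2 2]; ring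
    _ ≤ ((β ^ 3 / 2) ^ s) ^ (8 * s * b) * 2 ^ (8 * s ^ 2 * b) := by
        gcongr
        linarith
    _ = (β ^ 3 / 2 * 2) ^ (8 * s ^ 2 * b) := by rw [mul_pow]; ring
    _ = (β ^ (8 * s ^ 2 * b)) ^ 3 := by rw [div_mul_cancel₀ _ two_ne_zero]; ring

theorem exists_block_sizes {β : ℝ} (hβ : 2 < β ^ 3) : ∃ b s : ℕ, 0 < b ∧ 0 < s ∧
    ((b : ℝ) + 1) ^ (8 * s ^ 2) * 2 ^ ((8 * s ^ 2 * b + 8 * s * b) / 3) ≤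
      β ^ (8 * s ^ 2 * b) := by
  obtain ⟨s, hs⟩ := pow_unbounded_of_one_lt (4 : ℝ) (show 1 < β ^ 3 / 2 by linarith)
  obtain ⟨b, hb0, hb⟩ := exists_succ_pow_le_two_pow (3 * s)
  have hs0 : s ≠ 0 := by
    rintro rfl
    norm_num at hs
  have hβ0 : 0 ≤ β := (Odd.pow_nonneg_iff (by decide)).1 (show 0 ≤ β ^ 3 by linarith)
  exact ⟨b, s, hb0, Nat.pos_of_ne_zero hs0, keyBound_le_pow hβ0 hs.le hb⟩

/-! ### Signed lists of keys -/

/-- A natural number that stands for a key, and a bit that is set if the key counts negatively. -/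
abbrev SignedKey := ℕ × Bool

/-- The sign that a bit stands for. -/
def bitSign (s : Bool) : ℤ := if s then -1 else 1

theorem bitSign_xor (s t : Bool) : bitSign (s ^^ t) = bitSign s * bitSign t := by
  cases s <;> cases t <;> rfl

theorem bitSign_decide_eq_neg_one {z : ℤ} (hz : IsUnit z) : bitSign (decide (z = -1)) = z := by
  rcases Int.isUnit_iff.1 hz with rfl | rfl <;> rfl

/-- The number of pairs of entries of `A` and of `B` with the same key, each pair counted with the
sign of the entry of `B`. The sign bits of `A` do not matter. -/
def pairing (A B : List SignedKey) : ℤ :=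
  (A.map fun a => (B.map fun b => if a.1 = b.1 then bitSign b.2 else 0).sum).sum

theorem pairing_flatMap_left {ι : Type*} (A : List ι) (f : ι → List SignedKey)
    (B : List SignedKey) :
    pairing (A.flatMap f) B = (A.map fun a => pairing (f a) B).sum := by
  simp only [pairing, List.flatMap, List.map_flatten, List.sum_flatten, List.map_map,
    Function.comp_def]

theorem pairing_flatMap_right (A : List SignedKey) {ι : Type*} (B : List ι)
    (g : ι → List SignedKey) :
    pairing A (B.flatMap g) = (B.map fun b => pairing A (g b)).sum := by
  induction B with
  | nil => simp [pairing]
  | cons b B ih =>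
    simp only [pairing] at ih
    simp only [pairing, List.flatMap_cons, List.map_append, List.sum_append, List.sum_map_add, ih,
      List.map_cons, List.sum_cons]

theorem pairing_map_toList {κ : Type*} [DecidableEq κ] (A B : Finset κ) {e : κ → ℕ}
    (he : Function.Injective e) (t s : κ → Bool) :
    pairing (A.toList.map fun k => (e k, t k)) (B.toList.map fun k => (e k, s k)) =
      ∑ k ∈ A ∩ B, bitSign (s k) := by
  simp only [pairing, List.map_map, Function.comp_def, he.eq_iff, Finset.sum_map_toList,
    Finset.sum_ite_eq, Finset.sum_ite_mem]

/-- The entry that stands for the digit string of `a` extended by the digit of `k` in base `K`. -/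
def appendDigit (K : ℕ) (a k : SignedKey) : SignedKey := (K * a.1 + k.1, a.2 ^^ k.2)

theorem mul_add_eq_mul_add_iff {K a b k l : ℕ} (hk : k < K) (hl : l < K) :
    K * a + k = K * b + l ↔ a = b ∧ k = l := by
  have hK : 0 < K := by omega
  refine ⟨fun h => ?_, by rintro ⟨rfl, rfl⟩; rfl⟩
  have hdiv := congrArg (· / K) h
  have hmod := congrArg (· % K) h
  simpa [Nat.mul_add_div hK, Nat.mul_add_mod, Nat.div_eq_of_lt, Nat.mod_eq_of_lt, hk, hl] using
    And.intro hdiv hmod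

theorem pairing_map_appendDigit {K : ℕ} (a b : SignedKey) {F G : List SignedKey}
    (hF : ∀ k ∈ F, k.1 < K) (hG : ∀ k ∈ G, k.1 < K) :
    pairing (F.map (appendDigit K a)) (G.map (appendDigit K b)) =
      (if a.1 = b.1 then bitSign b.2 else 0) * pairing F G := by
  simp only [pairing, List.map_map, Function.comp_def, appendDigit, ← List.sum_map_mul_left]
  refine congrArg List.sum (List.map_congr_left fun k hk =>
    congrArg List.sum (List.map_congr_left fun l hl => ?_))
  simp only [mul_add_eq_mul_add_iff (hF k hk) (hG l hl), bitSign_xor, ite_zero_mul_ite_zero]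

theorem pairing_flatMap_appendDigit {K : ℕ} (A B : List SignedKey) {F G : List SignedKey}
    (hF : ∀ k ∈ F, k.1 < K) (hG : ∀ k ∈ G, k.1 < K) :
    pairing (A.flatMap fun a => F.map (appendDigit K a))
      (B.flatMap fun b => G.map (appendDigit K b)) = pairing A B * pairing F G := by
  rw [pairing_flatMap_left]
  simp only [pairing_flatMap_right, pairing_map_appendDigit _ _ hF hG, List.sum_map_mul_right]
  rfl

/-! ### Sparse factorizations of the disjointness matrix -/

/-- A factorization of the disjointness matrix of bit vectors of length `κ` into two matrices with
at most `L` nonzero entries in each row. The rows are given as lists of keys below `K`, and all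
entries are `1` or `-1`. -/
structure Factorization (κ K L : ℕ) where
  left : (Fin κ → Bool) → List SignedKey
  right : (Fin κ → Bool) → List SignedKey
  length_left_le : ∀ x, (left x).length ≤ L
  length_right_le : ∀ x, (right x).length ≤ L
  left_lt : ∀ x, ∀ k ∈ left x, k.1 < K
  right_lt : ∀ x, ∀ k ∈ right x, k.1 < K
  pairing_eq : ∀ x y, pairing (left x) (right y) = if ∀ i, ¬(x i ∧ y i) then 1 else 0

/-- The positions of the ones in the blocks of length `b` of a bit vector. -/
def blocks {m b : ℕ} (x : Fin (m * b) → Bool) (j : Fin m) : Finset (Fin b) :=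
  {i | x (finProdFinEquiv (j, i))}

theorem disjoint_blocks_iff {m b : ℕ} (x y : Fin (m * b) → Bool) :
    (∀ j, Disjoint (blocks x j) (blocks y j)) ↔ ∀ i, ¬(x i ∧ y i) := by
  simp only [blocks, Finset.disjoint_filter, Finset.mem_univ, true_imp_iff, not_and,
    ← finProdFinEquiv.forall_congr_right, Prod.forall]

theorem exists_factorization {β : ℝ} (hβ : 2 < β ^ 3) : ∃ κ K L : ℕ, 0 < κ ∧ 0 < L ∧
    (L : ℝ) ≤ β ^ κ ∧ Nonempty (Factorization κ K L) := by
  obtain ⟨b, s, hb, hs, hle⟩ := exists_block_sizes hβ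
  obtain ⟨f, hf⟩ := exists_card_keys_le b s
  let e := Fintype.equivFin (((Fin (8 * s ^ 2) → Fin (b + 1)) × (Fin (8 * s ^ 2) → Fin (b + 1))) ×
    (Fin (8 * s ^ 2) → Finset (Fin b)))
  refine ⟨8 * s ^ 2 * b, _, (b + 1) ^ (8 * s ^ 2) * 2 ^ ((8 * s ^ 2 * b + 8 * s * b) / 3),
    by positivity, by positivity, by exact_mod_cast hle, ⟨{
      left x := (keys (weights (blocks x), ·) f (blocks x)).toList.map fun k => (e k, false)
      right x := (keys (·, weights (blocks x)) (fun p j => (f p j).dual) (blocks x)).toList.map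
        fun k => (e k, decide (keySign f k = -1))
      length_left_le x := by simpa using (hf (blocks x)).1
      length_right_le x := by simpa using (hf (blocks x)).2
      left_lt x k hk := by
        obtain ⟨k, -, rfl⟩ := List.mem_map.1 hk
        exact (e k).is_lt
      right_lt x k hk := by
        obtain ⟨k, -, rfl⟩ := List.mem_map.1 hk
        exact (e k).is_lt
      pairing_eq x y := by
        rw [pairing_map_toList _ _ (e := fun k => (e k).val)
          (Fin.val_injective.comp e.injective)]
        simp only [bitSign_decide_eq_neg_one (isUnit_keySign _ _), sum_keySign,
          disjoint_blocks_iff] }⟩⟩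

/-- The keys of the first `D * κ` bits of a vector, where `F` lists the keys of a vector of `κ`
bits. They are numbered by their `D` digits in base `K`. -/
def leaves {κ : ℕ} (K : ℕ) (F : (Fin κ → Bool) → List SignedKey) (x : ℕ → Bool) :
    ℕ → List SignedKey
  | 0 => [(0, false)]
  | D + 1 => (leaves K F x D).flatMap fun a =>
      (F fun i => x (D * κ + i)).map (appendDigit K a)

section Leaves

variable {κ K L : ℕ} {F : (Fin κ → Bool) → List SignedKey}

theorem length_flatMap_le {α β : Type*} {l : List α} {f : α → List β} {c : ℕ}
    (h : ∀ a ∈ l, (f a).length ≤ c) : (l.flatMap f).length ≤ l.length * c := by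
  simpa [List.length_flatMap] using List.sum_le_card_nsmul (l.map fun a => (f a).length) c
    (by simpa using h)

theorem length_flatMap_range_le {α : Type*} {f : ℕ → List α} {m c : ℕ}
    (h : ∀ j < m, (f j).length ≤ c) : ((List.range m).flatMap f).length ≤ m * c := by
  simpa only [List.length_range] using length_flatMap_le fun j hj => h j (List.mem_range.1 hj)

theorem length_leaves_le (hF : ∀ x, (F x).length ≤ L) (x : ℕ → Bool) (D : ℕ) :
    (leaves K F x D).length ≤ L ^ D := by
  induction D with
  | zero => exact le_rfl
  | succ D ih =>
    rw [leaves, pow_succ]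
    refine (length_flatMap_le (c := L) fun a _ => ?_).trans (Nat.mul_le_mul_right L ih)
    rw [List.length_map]
    exact hF _

theorem mul_add_lt_mul {a b k K : ℕ} (ha : a < b) (hk : k < K) : K * a + k < K * b :=
  calc K * a + k < K * (a + 1) := by rw [mul_add_one]; exact Nat.add_lt_add_left hk _
    _ ≤ K * b := Nat.mul_le_mul_left K ha

theorem leaves_lt (hF : ∀ x, ∀ k ∈ F x, k.1 < K) (x : ℕ → Bool) (D : ℕ) :
    ∀ a ∈ leaves K F x D, a.1 < K ^ D := by
  induction D with
  | zero => simp [leaves]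
  | succ D ih =>
    simp only [leaves, List.mem_flatMap, List.mem_map]
    rintro _ ⟨a, ha, k, hk, rfl⟩
    rw [pow_succ']
    exact mul_add_lt_mul (ih a ha) (hF _ k hk)

theorem forall_lt_add_iff {p : ℕ → Prop} {m k : ℕ} :
    (∀ i < m + k, p i) ↔ (∀ i < m, p i) ∧ ∀ i : Fin k, p (m + i) := by
  refine ⟨fun h => ⟨fun i hi => h i (by omega), fun i => h _ (by omega)⟩, fun ⟨h, h'⟩ i hi => ?_⟩
  rcases lt_or_ge i m with him | him
  · exact h i him
  · simpa only [Nat.add_sub_cancel' him] using h' ⟨i - m, by omega⟩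

theorem Factorization.pairing_leaves (Φ : Factorization κ K L) (x y : ℕ → Bool) (D : ℕ) :
    pairing (leaves K Φ.left x D) (leaves K Φ.right y D) =
      if ∀ i < D * κ, ¬(x i ∧ y i) then 1 else 0 := by
  induction D with
  | zero => simp [leaves, pairing, bitSign]
  | succ D ih =>
    rw [leaves, leaves, pairing_flatMap_appendDigit _ _ (Φ.left_lt _) (Φ.right_lt _), ih,
      Φ.pairing_eq, Nat.succ_mul, ite_zero_mul_ite_zero, mul_one]
    exact if_congr forall_lt_add_iff.symm rfl rfl

end Leaves

end OrthogonalVectors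
namespace RAM

/-! ### Bounded states and the cost of an execution -/

/-- All registers and all cells hold numbers of at most `B` bits. -/
def Bounded (B : ℕ) (s : State) : Prop := (∀ i, s.reg i < 2 ^ B) ∧ ∀ a, s.mem a < 2 ^ B

theorem Bounded.mono {B B' : ℕ} {s : State} (h : Bounded B s) (hB : B ≤ B') : Bounded B' s :=
  have hpow : 2 ^ B ≤ 2 ^ B' := Nat.pow_le_pow_right two_pos hB
  ⟨fun i => (h.1 i).trans_le hpow, fun a => (h.2 a).trans_le hpow⟩

theorem Bounded.setReg {B : ℕ} {s : State} (h : Bounded B s) (i : ℕ) {x : ℕ} (hx : x < 2 ^ B) :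
    Bounded B (s.setReg i x) :=
  ⟨(Function.forall_update_iff s.reg fun _ y => y < 2 ^ B).2 ⟨hx, fun j _ => h.1 j⟩, h.2⟩

theorem Bounded.setMem {B : ℕ} {s : State} (h : Bounded B s) (a : ℕ) {x : ℕ} (hx : x < 2 ^ B) :
    Bounded B (s.setMem a x) :=
  ⟨h.1, (Function.forall_update_iff s.mem fun _ y => y < 2 ^ B).2 ⟨hx, fun j _ => h.2 j⟩⟩

namespace Program

/-- The number of instructions of a program, plus the length of its constants. -/
def weight : Program → ℕ
  | const _ c => 1 + c.size
  | seq p q => p.weight + q.weight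
  | cond _ p q => 1 + p.weight + q.weight
  | loop _ p => 1 + p.weight
  | _ => 1

/-- The program has no loop. -/
def Straight : Program → Prop
  | seq p q => p.Straight ∧ q.Straight
  | cond _ p q => p.Straight ∧ q.Straight
  | loop _ _ => False
  | _ => True

/-- The final state of a program without loops. Loops are treated as if they did nothing. -/
@[simp]
def eval : Program → State → State
  | skip, s => s
  | const i c, s => s.setReg i c
  | add i j k, s => s.setReg i (s.reg j + s.reg k)
  | sub i j k, s => s.setReg i (s.reg j - s.reg k)
  | load i j, s => s.setReg i (s.mem (s.reg j))
  | store i j, s => s.setMem (s.reg i) (s.reg j)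
  | seq p q, s => q.eval (p.eval s)
  | cond i p q, s => if s.reg i = 0 then q.eval s else p.eval s
  | loop _ _, s => s

end Program

theorem Bounded.eval {B : ℕ} {s : State} (hs : Bounded B s) (p : Program) :
    Bounded (B + p.weight) (p.eval s) := by
  induction p generalizing B s with
  | skip | loop => exact hs.mono (Nat.le_add_right _ _)
  | const i c =>
    refine (hs.mono (Nat.le_add_right _ _)).setReg i ((Nat.lt_size_self c).trans_le ?_)
    exact Nat.pow_le_pow_right two_pos (by simp only [Program.weight]; omega)
  | add i j k =>
    refine (hs.mono (Nat.le_add_right _ _)).setReg i ?_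
    have hj := hs.1 j
    have hk := hs.1 k
    simp only [Program.weight, pow_succ]
    omega
  | sub i j k =>
    refine (hs.mono (Nat.le_add_right _ _)).setReg i ?_
    exact (Nat.sub_le _ _).trans_lt ((hs.mono (Nat.le_add_right _ _)).1 j)
  | load i j =>
    exact (hs.mono (Nat.le_add_right _ _)).setReg i ((hs.mono (Nat.le_add_right _ _)).2 _)
  | store i j =>
    exact (hs.mono (Nat.le_add_right _ _)).setMem _ ((hs.mono (Nat.le_add_right _ _)).1 j)
  | seq p q ihp ihq =>
    exact (ihq (ihp hs)).mono (by simp only [Program.weight]; omega)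
  | cond i p q ihp ihq =>
    simp only [Program.eval]
    split_ifs
    · exact (ihq hs).mono (by simp only [Program.weight]; omega)
    · exact (ihp hs).mono (by simp only [Program.weight]; omega)

/-- The program `p` runs from `s` to `s'` at a cost that is justified by at most `k` passes through
loop bodies, if every number that occurs has at most `B` bits apart from a growth that is bounded
by the program. The cost is at most that of `p.weight` instructions for each of the `k` passes and
once more for the instructions outside of loops. -/
def Exec (B : ℕ) (p : Program) (s s' : State) (k : ℕ) : Prop :=
  ∃ t, Runs p s s' t ∧ t ≤ p.weight * (k + 1) * (2 * (B + p.weight) + 1)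

namespace Exec

variable {B k k' i : ℕ} {p q : Program} {s s' s'' : State}

theorem mono (h : Exec B p s s' k) (hk : k ≤ k') : Exec B p s s' k' := by
  obtain ⟨t, hrun, ht⟩ := h
  exact ⟨t, hrun, ht.trans (by gcongr)⟩

theorem seq (hp : Exec B p s s' k) (hq : Exec B q s' s'' k') :
    Exec B (.seq p q) s s'' (k + k') := by
  obtain ⟨t, hrun, ht⟩ := hp
  obtain ⟨t', hrun', ht'⟩ := hq
  refine ⟨_, hrun.seq hrun', ?_⟩
  calc t + t' ≤ p.weight * (k + 1) * (2 * (B + p.weight) + 1) +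
        q.weight * (k' + 1) * (2 * (B + q.weight) + 1) := Nat.add_le_add ht ht'
    _ ≤ p.weight * (k + k' + 1) * (2 * (B + (p.weight + q.weight)) + 1) +
        q.weight * (k + k' + 1) * (2 * (B + (p.weight + q.weight)) + 1) := by
      gcongr <;> omega
    _ = _ := by simp only [Program.weight]; ring

theorem test_add_le {t w : ℕ} {x : ℕ} (hx : x < 2 ^ B)
    (ht : t ≤ w * (k + 1) * (2 * (B + w) + 1)) {w' : ℕ} (hw : w < w') :
    1 + x.size + t ≤ w' * (k + 1) * (2 * (B + w') + 1) := by
  have hsize := Nat.size_le.2 hx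
  calc 1 + x.size + t ≤ (k + 1) * (2 * (B + w') + 1) + w * (k + 1) * (2 * (B + w') + 1) := by
        refine Nat.add_le_add ?_ (ht.trans (by gcongr))
        exact (by omega : 1 + x.size ≤ 2 * (B + w') + 1).trans (Nat.le_mul_of_pos_left _ k.succ_pos)
    _ = (w + 1) * (k + 1) * (2 * (B + w') + 1) := by ring
    _ ≤ w' * (k + 1) * (2 * (B + w') + 1) := by gcongr; exact hw

theorem cond_true (hi : s.reg i ≠ 0) (hB : s.reg i < 2 ^ B) (hp : Exec B p s s' k) :
    Exec B (.cond i p q) s s' k := by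
  obtain ⟨t, hrun, ht⟩ := hp
  exact ⟨_, .cond_true hi hrun, test_add_le hB ht (by simp only [Program.weight]; omega)⟩

theorem cond_false (hi : s.reg i = 0) (hq : Exec B q s s' k) : Exec B (.cond i p q) s s' k := by
  obtain ⟨t, hrun, ht⟩ := hq
  exact ⟨_, .cond_false hi hrun,
    test_add_le (hi ▸ Nat.two_pow_pos B) ht (by simp only [Program.weight]; omega)⟩

theorem loop_done (hi : s.reg i = 0) : Exec B (.loop i p) s s 0 :=
  ⟨_, .loop_done hi, test_add_le (t := 0) (w := 0) (hi ▸ Nat.two_pow_pos B) (Nat.zero_le _)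
    (by simp only [Program.weight]; omega)⟩

theorem loop_step (hi : s.reg i ≠ 0) (hB : s.reg i < 2 ^ B) (hp : Exec B p s s' k)
    (hloop : Exec B (.loop i p) s' s'' k') : Exec B (.loop i p) s s'' (k + 1 + k') := by
  obtain ⟨t, hrun, ht⟩ := hp
  obtain ⟨t', hrun', ht'⟩ := hloop
  refine ⟨_, .loop_step hi hrun hrun', ?_⟩
  have hbody := test_add_le hB ht (Nat.lt_one_add_iff.2 le_rfl)
  calc 1 + (s.reg i).size + t + t'
      ≤ (1 + p.weight) * (k + 1) * (2 * (B + (1 + p.weight)) + 1) +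
        (1 + p.weight) * (k' + 1) * (2 * (B + (1 + p.weight)) + 1) := Nat.add_le_add hbody ht'
    _ = _ := by simp only [Program.weight]; ring

theorem loop {σ : ℕ → State} {m : ℕ} (hdone : (σ m).reg i = 0)
    (hstep : ∀ j < m, (σ j).reg i ≠ 0 ∧ (σ j).reg i < 2 ^ B ∧ Exec B p (σ j) (σ (j + 1)) k) :
    Exec B (.loop i p) (σ 0) (σ m) (m * (k + 1)) := by
  induction m generalizing σ with
  | zero => exact (loop_done hdone).mono (Nat.zero_le _)
  | succ m ih =>
    obtain ⟨hi, hB, hp⟩ := hstep 0 m.succ_pos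
    have hloop := ih (σ := fun j => σ (j + 1)) hdone fun j hj => hstep _ (Nat.succ_lt_succ hj)
    exact (loop_step hi hB hp hloop).mono (by rw [Nat.succ_mul]; omega)

end Exec

theorem Program.Straight.exec {p : Program} (hp : p.Straight) {B : ℕ} {s : State}
    (hs : Bounded B s) : Exec B p s (p.eval s) 0 := by
  have hsize {B x : ℕ} (hx : x < 2 ^ B) : x.size ≤ B := Nat.size_le.2 hx
  induction p generalizing B s with
  | skip => exact ⟨_, .skip s, by simp [weight]⟩
  | const i c =>
    exact ⟨_, .const i c s, by
      rw [zero_add, mul_one]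
      exact Nat.le_mul_of_pos_right _ (Nat.succ_pos _)⟩
  | add i j k | sub i j k =>
    refine ⟨_, by constructor, ?_⟩
    have hj := hsize (hs.1 j)
    have hk := hsize (hs.1 k)
    simp only [weight]
    omega
  | load i j =>
    refine ⟨_, .load i j s, ?_⟩
    have hj := hsize (hs.1 j)
    have hmem := hsize (hs.2 (s.reg j))
    simp only [weight]
    omega
  | store i j =>
    refine ⟨_, .store i j s, ?_⟩
    have hi := hsize (hs.1 i)
    have hj := hsize (hs.1 j)
    simp only [weight]
    omega
  | seq p q ihp ihq =>
    obtain ⟨t, hrun, ht⟩ := ihp hp.1 hs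
    obtain ⟨t', hrun', ht'⟩ := ihq hp.2 (hs.eval p)
    refine ⟨_, hrun.seq hrun', ?_⟩
    calc t + t' ≤ p.weight * (0 + 1) * (2 * (B + p.weight) + 1) +
          q.weight * (0 + 1) * (2 * (B + p.weight + q.weight) + 1) := Nat.add_le_add ht ht'
      _ ≤ p.weight * (0 + 1) * (2 * (B + p.weight + q.weight) + 1) +
          q.weight * (0 + 1) * (2 * (B + p.weight + q.weight) + 1) :=
        Nat.add_le_add_right (Nat.mul_le_mul_left _ (by omega)) _
      _ = _ := by simp only [weight]; ring
  | cond i p q ihp ihq =>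
    simp only [eval]
    split_ifs with hi
    · exact .cond_false hi (ihq hp.2 hs)
    · exact .cond_true hi (hs.1 i) (ihp hp.1 hs)
  | loop => exact hp.elim

theorem Exec.of_eval_eq {p : Program} {B : ℕ} {s s' : State} (hp : p.Straight) (hs : Bounded B s)
    (h : p.eval s = s') : Exec B p s s' 0 :=
  h ▸ hp.exec hs

/-- The programs of a list, one after the other. -/
def Program.block : List Program → Program
  | [] => skip
  | p :: l => seq p (block l)

@[simp]
theorem Program.eval_block (l : List Program) (s : State) :
    (block l).eval s = l.foldl (fun s p => p.eval s) s := by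
  induction l generalizing s with
  | nil => rfl
  | cons p _ ih => exact ih _

theorem Program.straight_block {l : List Program} :
    (block l).Straight ↔ ∀ p ∈ l, p.Straight := by
  induction l with
  | nil => simp [block, Straight]
  | cons p l ih => simp [block, Straight, ih]

/-- The state with the given memory and the numbers of the list in its first registers. -/
def State.ofList (l : List ℕ) (m : ℕ → ℕ) : State := ⟨fun i => l.getD i 0, m⟩

namespace State

variable {l : List ℕ} {m : ℕ → ℕ}

@[simp]
theorem ofList_reg (i : ℕ) : (ofList l m).reg i = l.getD i 0 := rfl

@[simp]
theorem ofList_mem : (ofList l m).mem = m := rfl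

@[simp]
theorem ofList_setReg {i : ℕ} (hi : i < l.length) (x : ℕ) :
    (ofList l m).setReg i x = ofList (l.set i x) m := by
  simp only [ofList, setReg, mk.injEq, and_true]
  funext j
  by_cases hj : j = i
  · subst hj
    simp [hi]
  · simp [Function.update_of_ne hj, List.getElem?_set_ne (Ne.symm hj)]

@[simp]
theorem ofList_setMem (a x : ℕ) : (ofList l m).setMem a x = ofList l (Function.update m a x) := rfl

theorem bounded_ofList {B : ℕ} (hl : ∀ x ∈ l, x < 2 ^ B) (hm : ∀ a, m a < 2 ^ B) :
    Bounded B (ofList l m) := by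
  refine ⟨fun i => ?_, hm⟩
  rw [ofList_reg, List.getD_eq_getElem?_getD]
  cases h : l[i]? with
  | none => exact Nat.two_pow_pos B
  | some x => exact hl x (List.mem_of_getElem? h)

end State

end RAM

namespace OrthogonalVectors

open RAM

/-! ### The data structures of the program -/

/-- The memory cells `base`, `base + 3`, … hold the keys of the nodes, the cells behind them the
sign bits, and the cells behind those the counts. -/
def layout (input : ℕ → ℕ) (base : ℕ) (nodes : List SignedKey) (counts : ℕ → ℕ) (a : ℕ) : ℕ :=
  if a < base then input a
  else if (a - base) % 3 = 0 then (nodes[(a - base) / 3]?.getD (0, false)).1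
  else if (a - base) % 3 = 1 then (nodes[(a - base) / 3]?.getD (0, false)).2.toNat
  else counts ((a - base) / 3)

section Layout

variable (input : ℕ → ℕ) (base : ℕ) (nodes : List SignedKey) (counts : ℕ → ℕ)

theorem layout_of_lt {a : ℕ} (ha : a < base) : layout input base nodes counts a = input a :=
  if_pos ha

@[simp]
theorem layout_key (j : ℕ) :
    layout input base nodes counts (base + 3 * j) = (nodes[j]?.getD (0, false)).1 := by
  simp [layout]

@[simp]
theorem layout_sign (j : ℕ) :
    layout input base nodes counts (base + 3 * j + 1) = (nodes[j]?.getD (0, false)).2.toNat := by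
  simp only [layout]
  rw [if_neg (by omega), if_neg (by omega), if_pos (by omega),
    show (base + 3 * j + 1 - base) / 3 = j by omega]

@[simp]
theorem layout_count (w : ℕ) :
    layout input base nodes counts (base + 3 * w + 2) = counts w := by
  simp only [layout]
  rw [if_neg (by omega), if_neg (by omega), if_neg (by omega),
    show (base + 3 * w + 2 - base) / 3 = w by omega]

theorem getElem?_append_singleton {α : Type*} (l : List α) (a : α) (i : ℕ) :
    (l ++ [a])[i]? = if i = l.length then some a else l[i]? := by
  rcases lt_trichotomy i l.length with h | rfl | h
  · rw [List.getElem?_append_left h, if_neg h.ne]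
  · simp
  · rw [List.getElem?_eq_none (by simpa using h), List.getElem?_eq_none h.le, if_neg h.ne']

theorem update_layout_append (a : SignedKey) :
    Function.update (Function.update (layout input base nodes counts) (base + 3 * nodes.length) a.1)
      (base + 3 * nodes.length + 1) a.2.toNat = layout input base (nodes ++ [a]) counts := by
  funext i
  simp only [Function.update_apply, layout, getElem?_append_singleton]
  split_ifs <;> first | rfl | omega

@[simp]
theorem update_layout_count (w x : ℕ) :
    Function.update (layout input base nodes counts) (base + 3 * w + 2) x =
      layout input base nodes (Function.update counts w x) := by
  funext i
  simp only [Function.update_apply, layout]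
  split_ifs <;> first | rfl | omega

end Layout

/-- The nodes that were ever written to the queue: those that were taken from it, the rest of the
current level, and the next level. -/
structure Queue where
  past : List SignedKey
  level : List SignedKey
  next : List SignedKey

namespace Queue

/-- All nodes of the queue, in the order of their addresses. -/
def nodes (q : Queue) : List SignedKey := q.past ++ q.level ++ q.next

variable (P A N : List SignedKey) (a : SignedKey)

@[simp]
theorem getElem?_nodes_length_past : (nodes ⟨P, a :: A, N⟩)[P.length]? = some a := by
  simp [nodes]

@[simp]
theorem nodes_pop : nodes ⟨P ++ [a], A, N⟩ = nodes ⟨P, a :: A, N⟩ := by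
  simp [nodes]

@[simp]
theorem nodes_push : nodes ⟨P, A, N ++ [a]⟩ = nodes ⟨P, A, N⟩ ++ [a] := by
  simp [nodes]

end Queue

/-- The number of times that each left key occurs, and the totals of the counts that were looked up
by right keys with positive and with negative sign. -/
structure Tally where
  counts : ℕ → ℕ
  pos : ℕ
  neg : ℕ

/-- The part of a configuration that concerns the input: its cells, the numbers `n` and `d`, its
end, the position up to which it is read, and the numbers of rows and of bits of the current row
that remain to be read. -/
structure Reader where
  input : ℕ → ℕ
  n : ℕ
  d : ℕ
  base : ℕ
  cursor : ℕ
  rows : ℕ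
  bits : ℕ

/-- The registers `6`, `7` and `9` hold the addresses of the front and of the end of the queue and
of the end of the current level, and the registers `10`, …, `13` are for intermediate results. -/
def Reader.state (ρ : Reader) (q : Queue) (T : Tally) (key sign cosign temp : ℕ) : State :=
  .ofList [ρ.n, ρ.d, ρ.base, 1, ρ.cursor, ρ.rows, ρ.base + 3 * q.past.length,
      ρ.base + 3 * q.nodes.length, ρ.bits, ρ.base + 3 * (q.past ++ q.level).length,
      key, sign, cosign, temp, T.pos, T.neg]
    (layout ρ.input ρ.base q.nodes T.counts)

/-! ### The loop-free parts of the program -/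

/-- Move the address in register `i` on to the next node. -/
def advance (i : ℕ) : Program := .block [.add i i 3, .add i i 3, .add i i 3]

/-- Reset the registers for intermediate results. -/
def clearScratch : Program := .block [.const 10 0, .const 11 0, .const 12 0, .const 13 0]

/-- Read the next bit of the row into register `13`. The row is continued with zeros, so that its
length need not be a multiple of the block length. -/
def readBit : Program :=
  .cond 8 (.block [.load 13 4, .add 4 4 3, .sub 8 8 3]) (.const 13 0)

/-- Start a new row with the empty digit string as the only node. -/
def startQueue : Program :=
  .block [.store 7 13, .add 7 7 3, .store 7 13, .add 7 7 3, .add 7 7 3, .add 8 1 13]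

/-- Append a child to the queue. Register `10` holds the contribution of the parent to its key, and
the registers `11` and `12` hold the sign bit of the parent and its complement. -/
def emitNode (k : SignedKey) : Program :=
  .block [.const 13 k.1, .add 13 10 13, .store 7 13, .add 7 7 3,
    .store 7 (if k.2 then 12 else 11), .add 7 7 3, .add 7 7 3, .const 13 0]

/-- Take a node from the queue and load its key into register `13`, its sign bit into register `11`
and the complement of the bit into register `12`. -/
def loadNode : Program :=
  .block [.load 13 6, .add 6 6 3, .load 11 6, .add 6 6 3, .add 6 6 3, .sub 12 3 11]

/-- Add `K` times register `13` to register `10`. -/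
def addTimes (K : ℕ) : Program := .block (.replicate K (.add 10 10 13) ++ [.const 13 0])

/-- Replace a node by its children, one for each key in the list `G` of the next block. -/
def expandNode (K : ℕ) (G : List SignedKey) : Program :=
  .block [loadNode, addTimes K, .block (G.map emitNode), clearScratch]

/-- Compute the address of the count of the key in register `10`. -/
def countAddress : Program :=
  .block [.add 13 2 10, .add 13 13 10, .add 13 13 10, .add 13 13 3, .add 13 13 3]

/-- Take a left key from the queue and increase its count. -/
def countLeaf : Program :=
  .block [.load 10 6, advance 6, countAddress, .load 11 13, .add 11 11 3, .store 13 11,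
    clearScratch]

/-- Take a right key from the queue and add its count to the total for its sign. -/
def lookupLeaf : Program :=
  .block [.load 10 6, .add 6 6 3, .load 11 6, .add 6 6 3, .add 6 6 3, countAddress, .load 12 13,
    .cond 11 (.add 15 15 12) (.add 14 14 12), clearScratch]

/-- The effect of a left key. -/
def Tally.count (T : Tally) (a : SignedKey) : Tally :=
  { T with counts := Function.update T.counts a.1 (T.counts a.1 + 1) }

/-- The effect of a right key. -/
def Tally.lookup (T : Tally) (a : SignedKey) : Tally :=
  if a.2 then { T with neg := T.neg + T.counts a.1 } else { T with pos := T.pos + T.counts a.1 }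

section Eval

variable (ρ : Reader) (P A N : List SignedKey) (a : SignedKey) (T : Tally) (t : ℕ)

theorem add_three_mul_succ (x j : ℕ) : x + 3 * (j + 1) = x + 3 * j + 1 + 1 + 1 := rfl

theorem eval_emitNode (K : ℕ) (k : SignedKey) :
    (emitNode k).eval (ρ.state ⟨P, A, N⟩ T (K * a.1) a.2.toNat (!a.2).toNat 0) =
      ρ.state ⟨P, A, N ++ [appendDigit K a k]⟩ T (K * a.1) a.2.toNat (!a.2).toNat 0 := by
  have hmem := update_layout_append ρ.input ρ.base (Queue.nodes ⟨P, A, N⟩) T.counts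
    (appendDigit K a k)
  rcases k with ⟨k, s⟩
  cases s <;>
    simpa [emitNode, Reader.state, add_three_mul_succ, appendDigit] using congrArg _ hmem

theorem eval_emitNodes (K : ℕ) (G : List SignedKey) :
    (Program.block (G.map emitNode)).eval
        (ρ.state ⟨P, A, N⟩ T (K * a.1) a.2.toNat (!a.2).toNat 0) =
      ρ.state ⟨P, A, N ++ G.map (appendDigit K a)⟩ T (K * a.1) a.2.toNat (!a.2).toNat 0 := by
  induction G generalizing N with
  | nil => simp
  | cons k G ih =>
    rw [List.map_cons, Program.block, Program.eval, eval_emitNode, ih, List.map_cons,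
      List.append_assoc, List.singleton_append]

theorem eval_loadNode :
    loadNode.eval (ρ.state ⟨P, a :: A, N⟩ T 0 0 0 t) =
      ρ.state ⟨P ++ [a], A, N⟩ T 0 a.2.toNat (!a.2).toNat a.1 := by
  have hsign : 1 - a.2.toNat = (!a.2).toNat := by cases a.2 <;> rfl
  simp [loadNode, Reader.state, add_three_mul_succ, hsign]

theorem eval_addTimes (q : Queue) (key sign cosign K : ℕ) :
    (addTimes K).eval (ρ.state q T key sign cosign t) =
      ρ.state q T (key + K * t) sign cosign 0 := by
  induction K generalizing key with
  | zero => simp [addTimes, Reader.state]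
  | succ K ih =>
    have hadd : (Program.add 10 10 13).eval (ρ.state q T key sign cosign t) =
        ρ.state q T (key + t) sign cosign t := by simp [Reader.state]
    rw [addTimes, List.replicate_succ, List.cons_append, Program.block, Program.eval, hadd,
      ← addTimes, ih, Nat.succ_mul, add_assoc, add_comm t]

theorem eval_expandNode (K : ℕ) (G : List SignedKey) :
    (expandNode K G).eval (ρ.state ⟨P, a :: A, N⟩ T 0 0 0 t) =
      ρ.state ⟨P ++ [a], A, N ++ G.map (appendDigit K a)⟩ T 0 0 0 0 := by
  rw [expandNode, Program.block, Program.eval, eval_loadNode, Program.block, Program.eval,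
    eval_addTimes, zero_add, Program.block, Program.eval, eval_emitNodes]
  simp [clearScratch, Reader.state]

theorem eval_countLeaf :
    countLeaf.eval (ρ.state ⟨P, a :: A, N⟩ T 0 0 0 t) =
      ρ.state ⟨P ++ [a], A, N⟩ (T.count a) 0 0 0 0 := by
  have haddr : ρ.base + a.1 + a.1 + a.1 = ρ.base + 3 * a.1 := by ring
  simp [countLeaf, advance, countAddress, clearScratch, Reader.state, add_three_mul_succ, haddr,
    Tally.count]

theorem eval_lookupLeaf :
    lookupLeaf.eval (ρ.state ⟨P, a :: A, N⟩ T 0 0 0 t) =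
      ρ.state ⟨P ++ [a], A, N⟩ (T.lookup a) 0 0 0 0 := by
  have haddr : ρ.base + a.1 + a.1 + a.1 = ρ.base + 3 * a.1 := by ring
  cases hs : a.2 <;>
    simp [lookupLeaf, countAddress, clearScratch, Reader.state, add_three_mul_succ, haddr,
      Tally.lookup, hs]

theorem eval_startQueue :
    startQueue.eval (ρ.state ⟨P, [], []⟩ T 0 0 0 0) =
      { ρ with bits := ρ.d }.state ⟨P, [], [(0, false)]⟩ T 0 0 0 0 := by
  have hmem := update_layout_append ρ.input ρ.base (Queue.nodes ⟨P, [], []⟩) T.counts (0, false)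
  have hpush := Queue.nodes_push P [] [] (0, false)
  rw [List.nil_append] at hpush
  simpa [startQueue, Reader.state, add_three_mul_succ, hpush] using congrArg _ hmem

theorem straight_emitNode (k : SignedKey) : (emitNode k).Straight := by
  simp [emitNode, Program.straight_block, Program.Straight]

theorem straight_expandNode (K : ℕ) (G : List SignedKey) : (expandNode K G).Straight := by
  simp +contextual [expandNode, loadNode, addTimes, clearScratch, Program.straight_block,
    Program.Straight, straight_emitNode, or_imp, forall_and]

theorem straight_readBit : readBit.Straight := by
  simp [readBit, Program.straight_block, Program.Straight]

theorem straight_countLeaf : countLeaf.Straight := by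
  simp [countLeaf, advance, countAddress, clearScratch, Program.straight_block, Program.Straight]

theorem straight_lookupLeaf : lookupLeaf.Straight := by
  simp [lookupLeaf, countAddress, clearScratch, Program.straight_block, Program.Straight]

theorem straight_startQueue : startQueue.Straight := by
  simp [startQueue, Program.straight_block, Program.Straight]

end Eval

/-! ### Loops over the queue -/

/-- The numbers of the reader have at most `B` bits. -/
structure Reader.Fits (ρ : Reader) (B : ℕ) : Prop where
  pos : 0 < B
  input_lt : ∀ a, ρ.input a < 2 ^ B
  n_lt : ρ.n < 2 ^ B
  d_lt : ρ.d < 2 ^ B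
  rows_le : ρ.rows ≤ ρ.n
  bits_le : ρ.bits ≤ ρ.d
  cursor_add_bits_le : ρ.cursor + ρ.bits ≤ ρ.base

/-- The nodes in a queue behind the cell `base`, and their addresses, have at most `B` bits. -/
def Queue.Fits (q : Queue) (base B : ℕ) : Prop :=
  (∀ a ∈ q.nodes, a.1 < 2 ^ B) ∧ base + 3 * q.nodes.length < 2 ^ B

/-- The numbers of the tally have at most `B` bits. -/
def Tally.Fits (T : Tally) (B : ℕ) : Prop :=
  (∀ k, T.counts k < 2 ^ B) ∧ T.pos < 2 ^ B ∧ T.neg < 2 ^ B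

theorem Queue.Fits.mono {q q' : Queue} {base B : ℕ} (h : q'.Fits base B)
    (hq : q.nodes <+: q'.nodes) : q.Fits base B := by
  have hlength := hq.length_le
  exact ⟨fun a ha => h.1 a (hq.subset ha), by have := h.2; omega⟩

theorem layout_lt {input : ℕ → ℕ} {base B : ℕ} {nodes : List SignedKey} {counts : ℕ → ℕ}
    (hB : 0 < B) (hinput : ∀ a, input a < 2 ^ B) (hnodes : ∀ a ∈ nodes, a.1 < 2 ^ B)
    (hcounts : ∀ k, counts k < 2 ^ B) (a : ℕ) : layout input base nodes counts a < 2 ^ B := by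
  simp only [layout]
  split_ifs
  · exact hinput a
  · cases h : nodes[(a - base) / 3]? with
    | none => exact Nat.two_pow_pos B
    | some k => exact hnodes k (List.mem_of_getElem? h)
  · exact (Bool.toNat_lt _).trans_le (Nat.pow_le_pow_right two_pos hB)
  · exact hcounts _

section Exec

variable {B : ℕ} {ρ : Reader} {q : Queue} {T : Tally} {P A N : List SignedKey}

theorem bounded_state (hρ : ρ.Fits B) (hq : q.Fits ρ.base B) (hT : T.Fits B) {t : ℕ}
    (ht : t < 2 ^ B) : Bounded B (ρ.state q T 0 0 0 t) := by
  refine State.bounded_ofList ?_ (layout_lt hρ.pos hρ.input_lt hq.1 hT.1)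
  have hone : 1 < 2 ^ B := Nat.one_lt_two_pow hρ.pos.ne'
  have := hρ.n_lt
  have := hρ.d_lt
  have := hρ.rows_le
  have := hρ.bits_le
  have := hρ.cursor_add_bits_le
  have := hq.2
  have := hT.2
  have : q.nodes.length = (q.past ++ q.level).length + q.next.length := List.length_append
  have : (q.past ++ q.level).length = q.past.length + q.level.length := List.length_append
  simp only [List.mem_cons, List.not_mem_nil, or_false, forall_eq_or_imp, forall_eq]
  omega

/-- The program takes a node `a` from the queue, appends the nodes `f a` to the next level, and
changes the tally from `T` to `g T a`. -/
def NodeStep (body : Program) (f : SignedKey → List SignedKey) (g : Tally → SignedKey → Tally) :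
    Prop :=
  body.Straight ∧ ∀ (ρ : Reader) (P A N : List SignedKey) (a : SignedKey) (T : Tally) (t : ℕ),
    body.eval (ρ.state ⟨P, a :: A, N⟩ T 0 0 0 t) =
      ρ.state ⟨P ++ [a], A, N ++ f a⟩ (g T a) 0 0 0 0

theorem nodeStep_expandNode (K : ℕ) (G : List SignedKey) :
    NodeStep (expandNode K G) (fun a => G.map (appendDigit K a)) fun T _ => T :=
  ⟨straight_expandNode K G, fun ρ P A N a T t => eval_expandNode ρ P A N a T t K G⟩

theorem nodeStep_countLeaf : NodeStep countLeaf (fun _ => []) Tally.count :=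
  ⟨straight_countLeaf, fun ρ P A N a T t => by rw [eval_countLeaf, List.append_nil]⟩

theorem nodeStep_lookupLeaf : NodeStep lookupLeaf (fun _ => []) Tally.lookup :=
  ⟨straight_lookupLeaf, fun ρ P A N a T t => by rw [eval_lookupLeaf, List.append_nil]⟩

/-- Make the next level the current one, and run `body` on each of its nodes. -/
def drain (body : Program) : Program :=
  .seq (.block [.add 9 7 13, .sub 13 9 6]) (.loop 13 (.seq body (.sub 13 9 6)))

section Drain

variable {body : Program} {f : SignedKey → List SignedKey} {g : Tally → SignedKey → Tally}

theorem NodeStep.exec_loop (h : NodeStep body f g) (hρ : ρ.Fits B)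
    (hq : Queue.Fits ⟨P ++ A, [], N ++ A.flatMap f⟩ ρ.base B)
    (hT : ∀ A', A' <+: A → (A'.foldl g T).Fits B) :
    Exec B (.loop 13 (.seq body (.sub 13 9 6))) (ρ.state ⟨P, A, N⟩ T 0 0 0 (3 * A.length))
      (ρ.state ⟨P ++ A, [], N ++ A.flatMap f⟩ (A.foldl g T) 0 0 0 0) A.length := by
  induction A generalizing P N T with
  | nil => simpa using Exec.loop_done (by simp [Reader.state])
  | cons a A ih =>
    have hq' : Queue.Fits ⟨P, a :: A, N⟩ ρ.base B := hq.mono (by simp [Queue.nodes])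
    have hlt : 3 * (a :: A).length < 2 ^ B :=
      lt_of_le_of_lt (by simp [Queue.nodes]; omega) hq'.2
    have hbody : Exec B (.seq body (.sub 13 9 6))
        (ρ.state ⟨P, a :: A, N⟩ T 0 0 0 (3 * (a :: A).length))
        (ρ.state ⟨P ++ [a], A, N ++ f a⟩ (g T a) 0 0 0 (3 * A.length)) 0 := by
      have hstraight : (Program.seq body (.sub 13 9 6)).Straight := ⟨h.1, trivial⟩
      have hfits : T.Fits B := hT [] List.nil_prefix
      have hlength : ρ.base + 3 * (P.length + (A.length + 1)) - (ρ.base + 3 * (P.length + 1)) =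
          3 * A.length := by omega
      convert hstraight.exec (bounded_state hρ hq' hfits hlt) using 1
      rw [Program.eval, h.2]
      simp [Reader.state, hlength]
    have hloop := ih (P := P ++ [a]) (N := N ++ f a) (T := g T a) (by simpa using hq)
      fun A' hA' => hT (a :: A') (List.cons_prefix_cons.2 ⟨rfl, hA'⟩)
    rw [List.append_assoc, List.append_assoc] at hloop
    refine (Exec.loop_step ?_ ?_ hbody hloop).mono (by simp; omega)
    · simp [Reader.state]
    · exact hlt

theorem NodeStep.exec_drain (h : NodeStep body f g) (hρ : ρ.Fits B)
    (hq : Queue.Fits ⟨P ++ N, [], N.flatMap f⟩ ρ.base B)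
    (hT : ∀ A', A' <+: N → (A'.foldl g T).Fits B) :
    Exec B (drain body) (ρ.state ⟨P, [], N⟩ T 0 0 0 0)
      (ρ.state ⟨P ++ N, [], N.flatMap f⟩ (N.foldl g T) 0 0 0 0) N.length := by
  have hstraight : (Program.block [.add 9 7 13, .sub 13 9 6]).Straight := by
    simp [Program.straight_block, Program.Straight]
  have hfits : T.Fits B := hT [] List.nil_prefix
  have hq' : Queue.Fits ⟨P, [], N⟩ ρ.base B := hq.mono (by simp [Queue.nodes])
  have hstart := hstraight.exec (bounded_state hρ hq' hfits (Nat.two_pow_pos B))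
  have heval : (Program.block [.add 9 7 13, .sub 13 9 6]).eval (ρ.state ⟨P, [], N⟩ T 0 0 0 0) =
      ρ.state ⟨P, N, []⟩ T 0 0 0 (3 * N.length) := by
    simp [Reader.state, Queue.nodes, mul_add, Nat.add_sub_add_left]
  rw [heval] at hstart
  exact (hstart.seq (h.exec_loop hρ (by simpa using hq) hT)).mono (zero_add _).le

end Drain

end Exec

/-! ### Reading the rows -/

/-- The reader after `k` further steps, which read the rest of the current row and stay at its
end. -/
def Reader.after (ρ : Reader) (k : ℕ) : Reader :=
  { ρ with cursor := ρ.cursor + min k ρ.bits, bits := ρ.bits - k }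

/-- The rest of the current row is `x`, extended by zeros. -/
structure Reader.Reads (ρ : Reader) (x : ℕ → Bool) : Prop where
  input_eq : ∀ i < ρ.bits, ρ.input (ρ.cursor + i) = (x i).toNat
  eq_false : ∀ i, ρ.bits ≤ i → x i = false

/-- Read `κ` bits, padding the row with zeros, and continue with the program for these bits. -/
def branch : (κ : ℕ) → ((Fin κ → Bool) → Program) → Program
  | 0, f => f Fin.elim0
  | κ + 1, f =>
    .seq readBit (.cond 13 (.seq (.const 13 0) (branch κ fun x => f (Fin.cons true x)))
      (branch κ fun x => f (Fin.cons false x)))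

section Branch

variable {B : ℕ} {ρ : Reader} {q : Queue} {T : Tally} {x : ℕ → Bool}

theorem Reader.Fits.after (h : ρ.Fits B) (k : ℕ) : (ρ.after k).Fits B where
  pos := h.pos
  input_lt := h.input_lt
  n_lt := h.n_lt
  d_lt := h.d_lt
  rows_le := h.rows_le
  bits_le := (Nat.sub_le _ _).trans h.bits_le
  cursor_add_bits_le := by
    have := h.cursor_add_bits_le
    simp only [Reader.after]
    omega

theorem eval_readBit (hx : ρ.Reads x) (hbase : ρ.cursor + ρ.bits ≤ ρ.base) (j t : ℕ) :
    readBit.eval ((ρ.after j).state q T 0 0 0 t) =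
      (ρ.after (j + 1)).state q T 0 0 0 (x j).toNat := by
  rcases lt_or_ge j ρ.bits with hj | hj
  · have hbit : layout ρ.input ρ.base q.nodes T.counts (ρ.cursor + min j ρ.bits) =
        (x j).toNat := by
      rw [layout_of_lt _ _ _ _ (by omega), min_eq_left hj.le, hx.input_eq j hj]
    have hcursor : ρ.cursor + min j ρ.bits + 1 = ρ.cursor + min (j + 1) ρ.bits := by omega
    simp [readBit, Reader.state, Reader.after, Nat.sub_ne_zero_of_lt hj, hbit, hcursor, Nat.sub_sub]
  · have hmin : min (j + 1) ρ.bits = min j ρ.bits := by omega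
    simp [readBit, Reader.state, Reader.after, hx.eq_false j hj, hmin, Nat.sub_eq_zero_of_le hj,
      Nat.sub_eq_zero_of_le (hj.trans j.le_succ)]

theorem exec_branch (hρ : ρ.Fits B) (hq : q.Fits ρ.base B) (hT : T.Fits B) (hx : ρ.Reads x)
    {κ : ℕ} {f : (Fin κ → Bool) → Program} {j k : ℕ} {s : State}
    (hf : Exec B (f fun i => x (j + i)) ((ρ.after (j + κ)).state q T 0 0 0 0) s k) :
    Exec B (branch κ f) ((ρ.after j).state q T 0 0 0 0) s k := by
  induction κ generalizing j with
  | zero => rwa [Subsingleton.elim (fun i : Fin 0 => x (j + i)) Fin.elim0] at hf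
  | succ κ ih =>
    have hcons : (fun i : Fin (κ + 1) => x (j + i)) =
        Fin.cons (x j) fun i : Fin κ => x (j + 1 + i) := by
      rw [← Fin.cons_self_tail fun i : Fin (κ + 1) => x (j + i)]
      simp [Fin.tail_def, add_assoc, add_comm 1]
    rw [hcons, ← add_assoc, add_right_comm] at hf
    have hbit : (x j).toNat < 2 ^ B :=
      (Bool.toNat_lt _).trans_le (Nat.pow_le_pow_right two_pos hρ.pos)
    have hread := straight_readBit.exec (bounded_state (hρ.after j) hq hT (Nat.two_pow_pos B))
    rw [eval_readBit hx hρ.cursor_add_bits_le] at hread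
    refine (hread.seq ?_).mono (zero_add k).le
    cases hxj : x j with
    | false => exact .cond_false (by simp [Reader.state]) (ih (by simpa [hxj] using hf))
    | true =>
      rw [hxj] at hbit
      have hstraight : (Program.const 13 0).Straight := trivial
      have hclear := hstraight.exec (bounded_state (hρ.after (j + 1)) hq hT hbit)
      refine .cond_true (by simp [Reader.state]) (by simpa [Reader.state] using hbit)
        ((hclear.seq ?_).mono (zero_add k).le)
      simpa [Reader.state] using ih (f := fun y => f (Fin.cons true y)) (by simpa [hxj] using hf)

end Branch

/-- The nodes of the first `j` levels. -/
def levels {κ : ℕ} (K : ℕ) (F : (Fin κ → Bool) → List SignedKey) (x : ℕ → Bool) (j : ℕ) :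
    List SignedKey :=
  (List.range j).flatMap (leaves K F x)

/-- Read the current row in blocks of `κ` bits, and replace the only node of the queue by the leaves
of the row. -/
def expandLevels (κ K : ℕ) (F : (Fin κ → Bool) → List SignedKey) : Program :=
  .loop 8 (branch κ fun x => drain (expandNode K (F x)))

theorem flatMap_range_succ {α : Type*} (f : ℕ → List α) (j : ℕ) :
    (List.range (j + 1)).flatMap f = (List.range j).flatMap f ++ f j := by
  simp [List.range_succ]

theorem flatMap_range_prefix {α : Type*} (f : ℕ → List α) {j m : ℕ} (h : j ≤ m) :
    (List.range j).flatMap f <+: (List.range m).flatMap f := by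
  obtain ⟨k, rfl⟩ := Nat.exists_eq_add_of_le h
  simp [List.range_add, List.flatMap_append]

theorem exec_expandLevels {B : ℕ} {ρ : Reader} {T : Tally} {P : List SignedKey} {x : ℕ → Bool}
    {κ K D M : ℕ} {F : (Fin κ → Bool) → List SignedKey} (hρ : ρ.Fits B) (hT : T.Fits B)
    (hx : ρ.Reads x) (hD : ∀ j, D ≤ j ↔ ρ.bits ≤ j * κ)
    (hM : ∀ j < D, (leaves K F x j).length ≤ M)
    (hq : Queue.Fits ⟨P ++ levels K F x (D + 1), [], []⟩ ρ.base B) :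
    Exec B (expandLevels κ K F) (ρ.state ⟨P, [], [(0, false)]⟩ T 0 0 0 0)
      ((ρ.after (D * κ)).state ⟨P ++ levels K F x D, [], leaves K F x D⟩ T 0 0 0 0)
      (D * (M + 1)) := by
  have hfits (j : ℕ) (hj : j ≤ D) :
      Queue.Fits ⟨P ++ levels K F x j, [], leaves K F x j⟩ ρ.base B := by
    refine hq.mono ?_
    simpa [Queue.nodes, levels, flatMap_range_succ] using
      flatMap_range_prefix (leaves K F x) (Nat.succ_le_succ hj)
  let σ (j : ℕ) : State :=
    (ρ.after (j * κ)).state ⟨P ++ levels K F x j, [], leaves K F x j⟩ T 0 0 0 0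
  have hσ : σ 0 = ρ.state ⟨P, [], [(0, false)]⟩ T 0 0 0 0 := by
    simp [σ, Reader.after, levels, leaves]
  rw [← hσ]
  refine Exec.loop (σ := σ) ?_ fun j hj => ⟨?_, ?_, ?_⟩
  · simpa [σ, Reader.state, Reader.after] using Nat.sub_eq_zero_of_le ((hD D).1 le_rfl)
  · have hbits : j * κ < ρ.bits := by simpa using (hD j).not.1 hj.not_ge
    simpa [σ, Reader.state, Reader.after] using Nat.sub_ne_zero_of_lt hbits
  · have hbits := (Nat.sub_le ρ.bits (j * κ)).trans hρ.bits_le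
    simpa [σ, Reader.state, Reader.after] using hbits.trans_lt hρ.d_lt
  · refine exec_branch hρ (hfits j hj.le) hT hx ?_
    have hlevels : levels K F x (j + 1) = levels K F x j ++ leaves K F x j := flatMap_range_succ _ _
    have hnext := hfits (j + 1) hj
    rw [hlevels, ← List.append_assoc] at hnext
    have hdrain := (nodeStep_expandNode K (F fun i => x (j * κ + i))).exec_drain
      (hρ.after (j * κ + κ)) (T := T) hnext fun A' _ => by rwa [List.foldl_fixed]
    rw [List.foldl_fixed, List.append_assoc, ← hlevels] at hdrain
    simpa only [σ, add_one_mul, leaves] using hdrain.mono (hM j hj)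

/-- The reader in front of row `j` of the `ρ.n` rows that start at the cursor of `ρ`. -/
def Reader.atRow (ρ : Reader) (j : ℕ) : Reader :=
  { ρ with cursor := ρ.cursor + j * ρ.d, rows := ρ.n - j, bits := 0 }

/-- The reader at the first bit of row `j` of the `ρ.n` rows that start at the cursor of `ρ`. -/
def Reader.row (ρ : Reader) (j : ℕ) : Reader := { ρ.atRow j with bits := ρ.d }

/-- The leaves of the first `n` rows of a table. -/
def tableLeaves {κ : ℕ} (K : ℕ) (F : (Fin κ → Bool) → List SignedKey) (x : ℕ → ℕ → Bool)
    (D n : ℕ) : List SignedKey :=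
  (List.range n).flatMap fun i => leaves K F (x i) D

/-- All the nodes that are generated from the first `n` rows of a table. -/
def tableLevels {κ : ℕ} (K : ℕ) (F : (Fin κ → Bool) → List SignedKey) (x : ℕ → ℕ → Bool)
    (D n : ℕ) : List SignedKey :=
  (List.range n).flatMap fun i => levels K F (x i) (D + 1)

/-- Read a row, and use `leaf` on its leaves. -/
def readRow (κ K : ℕ) (F : (Fin κ → Bool) → List SignedKey) (leaf : Program) : Program :=
  .block [startQueue, expandLevels κ K F, drain leaf, .sub 5 5 3]

/-- Read the next `n` rows, and use `leaf` on their leaves. -/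
def readTable (κ K : ℕ) (F : (Fin κ → Bool) → List SignedKey) (leaf : Program) : Program :=
  .seq (.add 5 0 13) (.loop 5 (readRow κ K F leaf))

section Table

variable {B : ℕ} {ρ : Reader} {P : List SignedKey} {T : Tally} {κ K D M : ℕ}
  {F : (Fin κ → Bool) → List SignedKey} {leaf : Program} {g : Tally → SignedKey → Tally}

theorem Reader.Fits.atRow (h : ρ.Fits B) (hcursor : ρ.cursor + ρ.n * ρ.d ≤ ρ.base) {j : ℕ}
    (hj : j ≤ ρ.n) : (ρ.atRow j).Fits B where
  pos := h.pos
  input_lt := h.input_lt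
  n_lt := h.n_lt
  d_lt := h.d_lt
  rows_le := Nat.sub_le _ _
  bits_le := Nat.zero_le _
  cursor_add_bits_le := by
    have := Nat.mul_le_mul_right ρ.d hj
    simp only [Reader.atRow]
    omega

theorem Reader.Fits.row (h : ρ.Fits B) (hcursor : ρ.cursor + ρ.n * ρ.d ≤ ρ.base) {j : ℕ}
    (hj : j < ρ.n) : (ρ.row j).Fits B :=
  { h.atRow hcursor hj.le with
    bits_le := le_rfl
    cursor_add_bits_le := by
      have := (h.atRow hcursor hj).cursor_add_bits_le
      simp only [Reader.atRow, Reader.row, Nat.succ_mul] at this ⊢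
      omega }

theorem exec_readRow (hleaf : NodeStep leaf (fun _ => []) g) (hρ : ρ.Fits B)
    (hcursor : ρ.cursor + ρ.n * ρ.d ≤ ρ.base) {j : ℕ} (hj : j < ρ.n) {x : ℕ → Bool}
    (hx : (ρ.row j).Reads x) (hD : ∀ j, D ≤ j ↔ ρ.d ≤ j * κ)
    (hM : ∀ j ≤ D, (leaves K F x j).length ≤ M)
    (hq : Queue.Fits ⟨P ++ levels K F x (D + 1), [], []⟩ ρ.base B)
    (hT : ∀ A', A' <+: leaves K F x D → (A'.foldl g T).Fits B) :
    Exec B (readRow κ K F leaf) ((ρ.atRow j).state ⟨P, [], []⟩ T 0 0 0 0)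
      ((ρ.atRow (j + 1)).state ⟨P ++ levels K F x (D + 1), [], []⟩
        ((leaves K F x D).foldl g T) 0 0 0 0) (D * (M + 1) + M) := by
  have hstart := straight_startQueue.exec (bounded_state (hρ.atRow hcursor hj.le)
    (hq.mono (q := ⟨P, [], []⟩) (by simp [Queue.nodes])) (hT [] List.nil_prefix)
    (Nat.two_pow_pos B))
  rw [List.foldl_nil, eval_startQueue] at hstart
  have hrow : (ρ.row j).Fits B := hρ.row hcursor hj
  have hlevels := exec_expandLevels hrow (hT [] List.nil_prefix) hx hD (fun j hj => hM j hj.le) hq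
  have hsucc : levels K F x (D + 1) = levels K F x D ++ leaves K F x D := flatMap_range_succ _ _
  have hempty : (leaves K F x D).flatMap (fun _ => ([] : List SignedKey)) = [] := by simp
  have hdrain := hleaf.exec_drain (P := P ++ levels K F x D) (hrow.after (D * κ))
    (by rwa [hempty, List.append_assoc, ← hsucc]) hT
  rw [hempty, List.append_assoc, ← hsucc] at hdrain
  have hstraight : (Program.block [.sub 5 5 3]).Straight := by
    simp [Program.straight_block, Program.Straight]
  have hend := hstraight.exec (bounded_state (hrow.after (D * κ)) hq (hT _ List.prefix_rfl)
    (Nat.two_pow_pos B))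
  have heval : (Program.block [.sub 5 5 3]).eval (((ρ.row j).after (D * κ)).state
      ⟨P ++ levels K F x (D + 1), [], []⟩ ((leaves K F x D).foldl g T) 0 0 0 0) =
      (ρ.atRow (j + 1)).state ⟨P ++ levels K F x (D + 1), [], []⟩
        ((leaves K F x D).foldl g T) 0 0 0 0 := by
    have hd : ρ.d ≤ D * κ := (hD D).1 le_rfl
    simp [Reader.state, Reader.after, Reader.row, Reader.atRow, hd, add_one_mul, add_assoc,
      Nat.sub_sub]
  rw [heval] at hend
  exact (hstart.seq (hlevels.seq (hdrain.seq hend))).mono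
    (by have := hM D le_rfl; omega)

theorem exec_readTable (hleaf : NodeStep leaf (fun _ => []) g) (hρ : ρ.Fits B)
    (hbits : ρ.bits = 0) (hcursor : ρ.cursor + ρ.n * ρ.d ≤ ρ.base)
    {x : ℕ → ℕ → Bool} (hx : ∀ j < ρ.n, (ρ.row j).Reads (x j))
    (hD : ∀ j, D ≤ j ↔ ρ.d ≤ j * κ) (hM : ∀ i, ∀ j ≤ D, (leaves K F (x i) j).length ≤ M)
    (hq : Queue.Fits ⟨P ++ tableLevels K F x D ρ.n, [], []⟩ ρ.base B)
    (hT : ∀ A, A <+: tableLeaves K F x D ρ.n → (A.foldl g T).Fits B) :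
    Exec B (readTable κ K F leaf) (ρ.state ⟨P, [], []⟩ T 0 0 0 0)
      ((ρ.atRow ρ.n).state ⟨P ++ tableLevels K F x D ρ.n, [], []⟩
        ((tableLeaves K F x D ρ.n).foldl g T) 0 0 0 0)
      (ρ.n * ((D + 1) * (M + 1))) := by
  have hfits (j : ℕ) (hj : j ≤ ρ.n) :
      Queue.Fits ⟨P ++ tableLevels K F x D j, [], []⟩ ρ.base B :=
    hq.mono (by simpa [Queue.nodes, tableLevels] using flatMap_range_prefix _ hj)
  let σ (j : ℕ) : State := (ρ.atRow j).state ⟨P ++ tableLevels K F x D j, [], []⟩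
    ((tableLeaves K F x D j).foldl g T) 0 0 0 0
  have hstart : Exec B (.add 5 0 13) (ρ.state ⟨P, [], []⟩ T 0 0 0 0) (σ 0) 0 := by
    refine .of_eval_eq trivial (bounded_state hρ (hq.mono (by simp [Queue.nodes]))
      (hT [] List.nil_prefix) (Nat.two_pow_pos B)) ?_
    simp [σ, tableLevels, tableLeaves, Reader.state, Reader.atRow, hbits]
  refine (hstart.seq (Exec.loop (σ := σ) (k := D * (M + 1) + M) ?_ fun j hj => ⟨?_, ?_, ?_⟩)).mono
    (le_of_eq (by ring))
  · simp [σ, Reader.state, Reader.atRow]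
  · simpa [σ, Reader.state, Reader.atRow] using Nat.sub_ne_zero_of_lt hj
  · simpa [σ, Reader.state, Reader.atRow] using (Nat.sub_le _ _).trans_lt hρ.n_lt
  · have hlevels : tableLevels K F x D (j + 1) =
        tableLevels K F x D j ++ levels K F (x j) (D + 1) := flatMap_range_succ _ _
    have hleaves : tableLeaves K F x D (j + 1) = tableLeaves K F x D j ++ leaves K F (x j) D :=
      flatMap_range_succ _ _
    have hrow := exec_readRow (P := P ++ tableLevels K F x D j)
      (T := (tableLeaves K F x D j).foldl g T) hleaf hρ hcursor hj (hx j hj) hD (hM j)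
      (by simpa only [List.append_assoc, ← hlevels] using hfits (j + 1) hj)
      fun A hA => by
        have hprefix : tableLeaves K F x D j ++ A <+: tableLeaves K F x D (j + 1) :=
          hleaves ▸ (List.prefix_append_right_inj _).2 hA
        rw [← List.foldl_append]
        exact hT _ (hprefix.trans (flatMap_range_prefix _ hj))
    simpa only [List.append_assoc, ← hlevels, ← List.foldl_append, ← hleaves] using hrow

end Table

/-! ### Correctness of the count -/

/-- The tally before any key is read. -/
def Tally.empty : Tally := ⟨fun _ => 0, 0, 0⟩

theorem foldl_count (A : List SignedKey) (T : Tally) :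
    A.foldl Tally.count T =
      { T with counts := fun k => T.counts k + (A.map Prod.fst).count k } := by
  induction A generalizing T with
  | nil => simp
  | cons a A ih =>
    rw [List.foldl_cons, ih]
    simp only [Tally.count, Tally.mk.injEq, and_true, List.map_cons, List.count_cons]
    funext k
    rcases eq_or_ne a.1 k with rfl | h
    · simp only [Function.update_self, beq_self_eq_true, if_true]
      ring
    · simp [Function.update_of_ne h.symm, h]

theorem counts_foldl_lookup (A : List SignedKey) (T : Tally) :
    (A.foldl Tally.lookup T).counts = T.counts := by
  induction A generalizing T with
  | nil => rfl
  | cons a A ih =>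
    rw [List.foldl_cons, ih, Tally.lookup]
    split_ifs <;> rfl

theorem pos_sub_neg_foldl_lookup (A : List SignedKey) (T : Tally) :
    ((A.foldl Tally.lookup T).pos : ℤ) - (A.foldl Tally.lookup T).neg =
      T.pos - T.neg + (A.map fun a => bitSign a.2 * (T.counts a.1 : ℤ)).sum := by
  induction A generalizing T with
  | nil => simp
  | cons a A ih =>
    have hcounts : (T.lookup a).counts = T.counts := counts_foldl_lookup [a] T
    rw [List.foldl_cons, ih, hcounts, List.map_cons, List.sum_cons]
    cases ha : a.2 <;> simp [Tally.lookup, bitSign, ha] <;> ring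

theorem pos_add_neg_foldl_lookup_le (A : List SignedKey) (T : Tally) {m : ℕ}
    (hm : ∀ k, T.counts k ≤ m) :
    (A.foldl Tally.lookup T).pos + (A.foldl Tally.lookup T).neg ≤
      T.pos + T.neg + A.length * m := by
  induction A generalizing T with
  | nil => simp
  | cons a A ih =>
    have hcounts : (T.lookup a).counts = T.counts := counts_foldl_lookup [a] T
    have hstep : (T.lookup a).pos + (T.lookup a).neg = T.pos + T.neg + T.counts a.1 := by
      rw [Tally.lookup]
      split_ifs <;> ring
    rw [List.foldl_cons, List.length_cons, add_one_mul]
    have := ih (T.lookup a) (hcounts ▸ hm)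
    have := hm a.1
    omega

theorem fits_foldl_count {A : List SignedKey} {B : ℕ} (h : A.length < 2 ^ B) :
    (A.foldl Tally.count .empty).Fits B := by
  rw [foldl_count]
  refine ⟨fun k => ?_, Nat.two_pow_pos B, Nat.two_pow_pos B⟩
  simpa [Tally.empty] using List.count_le_length.trans_lt (List.length_map Prod.fst ▸ h)

theorem fits_foldl_lookup {A A' : List SignedKey} {B : ℕ} (h : A.length < 2 ^ B)
    (h' : A'.length * A.length < 2 ^ B) :
    (A'.foldl Tally.lookup (A.foldl Tally.count .empty)).Fits B := by
  have hle := pos_add_neg_foldl_lookup_le A' (A.foldl Tally.count .empty) (m := A.length)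
    fun k => by
    rw [foldl_count]
    simpa [Tally.empty] using List.count_le_length (l := A.map Prod.fst) (a := k)
  have hzero : (A.foldl Tally.count .empty).pos + (A.foldl Tally.count .empty).neg = 0 := by
    rw [foldl_count]
    rfl
  refine ⟨?_, by omega, by omega⟩
  rw [counts_foldl_lookup]
  exact (fits_foldl_count h).1

theorem pairing_eq_sum_count (A A' : List SignedKey) :
    pairing A A' = (A'.map fun a => bitSign a.2 * ((A.map Prod.fst).count a.1 : ℤ)).sum := by
  induction A with
  | nil => simp [pairing]
  | cons c A ih =>
    have hcons : pairing (c :: A) A' =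
        (A'.map fun a => if c.1 = a.1 then bitSign a.2 else 0).sum + pairing A A' := rfl
    rw [hcons, ih, ← List.sum_map_add]
    refine congrArg List.sum (List.map_congr_left fun a _ => ?_)
    rw [List.map_cons, List.count_cons]
    by_cases h : c.1 = a.1
    · simp only [h, beq_self_eq_true, if_true]
      push_cast
      ring
    · simp [h]

theorem pos_sub_neg_eq_pairing (A A' : List SignedKey) :
    ((A'.foldl Tally.lookup (A.foldl Tally.count .empty)).pos : ℤ) -
      (A'.foldl Tally.lookup (A.foldl Tally.count .empty)).neg = pairing A A' := by
  rw [pos_sub_neg_foldl_lookup, pairing_eq_sum_count, foldl_count]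
  simp [Tally.empty]

section Input

variable {n d : ℕ}

/-- The rows of a table of bits, extended by zeros. -/
def rowBits (u : Fin n → Fin d → Bool) (j i : ℕ) : Bool :=
  if h : j < n ∧ i < d then u ⟨j, h.1⟩ ⟨i, h.2⟩ else false

theorem rowBits_fin (u : Fin n → Fin d → Bool) (j : Fin n) (i : Fin d) :
    rowBits u j i = u j i := by
  simp [rowBits]

theorem rowBits_of_le (u : Fin n → Fin d → Bool) (j : ℕ) {i : ℕ} (h : d ≤ i) :
    rowBits u j i = false := by
  simp [rowBits, h.not_gt]

theorem sum_toNat_mul_toNat_eq_zero_iff (u v : Fin n → Fin d → Bool) (l j : Fin n) {m : ℕ}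
    (hm : d ≤ m) :
    ∑ i, ((u l i).toNat : ℤ) * ((v j i).toNat : ℤ) = 0 ↔
      ∀ i < m, ¬(rowBits u l i ∧ rowBits v j i) := by
  have hprod (i : Fin d) : ((u l i).toNat : ℤ) * ((v j i).toNat : ℤ) = 0 ↔
      ¬(rowBits u l i ∧ rowBits v j i) := by
    rw [rowBits_fin, rowBits_fin]
    cases u l i <;> cases v j i <;> simp
  rw [Finset.sum_eq_zero_iff_of_nonneg fun _ _ => by positivity]
  simp only [Finset.mem_univ, true_imp_iff, hprod]
  refine ⟨fun h i _ hi => ?_, fun h i => h i (i.is_lt.trans_le hm)⟩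
  rcases lt_or_ge i d with hid | hid
  · exact h ⟨i, hid⟩ hi
  · exact Bool.false_ne_true ((rowBits_of_le u l hid).symm.trans hi.1)

theorem count_eq_pairing {κ K L D : ℕ} (Φ : Factorization κ K L) (hD : d ≤ D * κ)
    (u v : Fin n → Fin d → Bool) :
    (count u v : ℤ) = pairing (tableLeaves K Φ.left (rowBits u) D n)
      (tableLeaves K Φ.right (rowBits v) D n) := by
  have hsum (f : ℕ → ℤ) : ((List.range n).map f).sum = ∑ l : Fin n, f l := by
    rw [← Finset.sum_range]
    rfl
  rw [tableLeaves, pairing_flatMap_left]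
  simp only [tableLeaves, pairing_flatMap_right, Φ.pairing_leaves, hsum,
    ← sum_toNat_mul_toNat_eq_zero_iff u v _ _ hD]
  rw [count, Finset.card_filter, ← Finset.univ_product_univ, Finset.sum_product]
  push_cast
  rfl

theorem mul_add_lt_mul_of_lt {l i : ℕ} (hl : l < n) (hi : i < d) : l * d + i < n * d := by
  have := mul_add_lt_mul hl hi
  rwa [mul_comm d, mul_comm d] at this

theorem entry_eq_rowBits (u : Fin n → Fin d → Bool) {l i : ℕ} (hl : l < n) (hi : i < d) :
    entry u (l * d + i) = (rowBits u l i).toNat := by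
  have hd : 0 < d := by omega
  have hdiv : (l * d + i) / d = l := by
    rw [mul_comm, Nat.mul_add_div hd, Nat.div_eq_of_lt hi, add_zero]
  have hmod : (l * d + i) % d = i := by rw [Nat.mul_add_mod', Nat.mod_eq_of_lt hi]
  simp only [entry, mul_add_lt_mul_of_lt hl hi, dif_pos, rowBits, hl, hi, and_self, hdiv, hmod]

/-- The reader at the start of the program. -/
def tableReader (u v : Fin n → Fin d → Bool) : Reader where
  input := (input u v).mem
  n := n
  d := d
  base := 2 * (n * d)
  cursor := 0
  rows := 0
  bits := 0

theorem reads_rowBits_left (u v : Fin n → Fin d → Bool) {l : ℕ} (hl : l < n) :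
    ((tableReader u v).row l).Reads (rowBits u l) where
  input_eq i hi := by
    have hlt : l * d + i < n * d := mul_add_lt_mul_of_lt hl hi
    simp only [Reader.row, Reader.atRow, tableReader, input, zero_add]
    rw [if_pos hlt]
    exact entry_eq_rowBits u hl hi
  eq_false _ h := rowBits_of_le u l h

theorem reads_rowBits_right (u v : Fin n → Fin d → Bool) {j : ℕ} (hj : j < n) :
    (((tableReader u v).atRow n).row j).Reads (rowBits v j) where
  input_eq i hi := by
    have hle : ¬n * d + j * d + i < n * d := by omega
    simp only [Reader.row, Reader.atRow, tableReader, input, zero_add, if_neg hle]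
    rw [add_assoc, Nat.add_sub_cancel_left]
    exact entry_eq_rowBits v hj hi
  eq_false _ h := rowBits_of_le v j h

theorem entry_le_one (u : Fin n → Fin d → Bool) (a : ℕ) : entry u a ≤ 1 := by
  rw [entry]
  split_ifs
  · exact Bool.toNat_le _
  · exact Nat.zero_le _

theorem input_mem_le_one (u v : Fin n → Fin d → Bool) (a : ℕ) : (input u v).mem a ≤ 1 := by
  simp only [input]
  split_ifs <;> exact entry_le_one _ _

theorem input_eq_ofList (u v : Fin n → Fin d → Bool) :
    input u v = .ofList (n :: d :: List.replicate 14 0) (input u v).mem := by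
  simp only [State.ofList, input, State.mk.injEq, and_true]
  funext i
  rcases i with _ | _ | i
  · rfl
  · rfl
  · rw [if_neg (by omega), if_neg (by omega), List.getD_cons_succ, List.getD_cons_succ,
      List.getD_eq_getElem?_getD, List.getElem?_replicate]
    split_ifs <;> rfl

theorem layout_input (u v : Fin n → Fin d → Bool) :
    layout (input u v).mem (2 * (n * d)) [] (fun _ => 0) = (input u v).mem := by
  funext a
  simp only [layout, input, List.getElem?_nil, Option.getD_none, Bool.toNat_false, ite_self]
  split_ifs with hbase hleft hleft
  · rfl
  · rfl
  · omega
  · rw [entry, dif_neg (by omega)]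

end Input

/-! ### The program -/

/-- Set the registers to their values in the state of `tableReader` with an empty queue. The address
`2 * n * d` of the queue is computed by adding `2 * d` repeatedly. -/
def setBase : Program :=
  .seq (.block [.const 3 1, .add 5 0 13]) <|
    .seq (.loop 5 (.block [.add 2 2 1, .add 2 2 1, .sub 5 5 3]))
      (.block [.add 6 2 13, .add 7 2 13, .add 9 2 13])

/-- Count the left keys, look up the right keys, and subtract. -/
def countProgram (κ K : ℕ) (F G : (Fin κ → Bool) → List SignedKey) : Program :=
  .block [setBase, readTable κ K F countLeaf, readTable κ K G lookupLeaf, .sub 0 14 15]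

section Setup

variable {n d B : ℕ} (u v : Fin n → Fin d → Bool)

theorem fits_tableReader (hB : 0 < B) (hn : n < 2 ^ B) (hd : d < 2 ^ B) :
    (tableReader u v).Fits B where
  pos := hB
  input_lt a := (input_mem_le_one u v a).trans_lt (Nat.one_lt_two_pow hB.ne')
  n_lt := hn
  d_lt := hd
  rows_le := Nat.zero_le n
  bits_le := Nat.zero_le d
  cursor_add_bits_le := Nat.zero_le _

theorem exec_setBase (hB : 0 < B) (hn : n < 2 ^ B) (hd : d < 2 ^ B) (hbase : 2 * (n * d) < 2 ^ B) :
    Exec B setBase (input u v) ((tableReader u v).state ⟨[], [], []⟩ .empty 0 0 0 0) n := by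
  have hone : 1 < 2 ^ B := Nat.one_lt_two_pow hB.ne'
  have hmem (a : ℕ) : (input u v).mem a < 2 ^ B := (input_mem_le_one u v a).trans_lt hone
  let σ (j : ℕ) : State :=
    .ofList [n, d, 2 * (j * d), 1, 0, n - j, 0, 0, 0, 0, 0, 0, 0, 0, 0, 0] (input u v).mem
  have hinput : Bounded B (input u v) := by
    rw [input_eq_ofList]
    refine State.bounded_ofList ?_ hmem
    simp only [List.mem_cons, List.mem_replicate, forall_eq_or_imp]
    exact ⟨hn, hd, fun _ h => h.2 ▸ Nat.two_pow_pos B⟩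
  have hσ (j : ℕ) (hj : j ≤ n) : Bounded B (σ j) := by
    refine State.bounded_ofList ?_ hmem
    have := Nat.mul_le_mul_right d hj
    simp only [List.mem_cons, List.not_mem_nil, or_false, forall_eq_or_imp, forall_eq]
    omega
  have hstart : Exec B (.block [.const 3 1, .add 5 0 13]) (input u v) (σ 0) 0 := by
    refine .of_eval_eq (Program.straight_block.2 (by simp [Program.Straight])) hinput ?_
    rw [input_eq_ofList]
    simp [σ]
  have hstep (j : ℕ) (hj : j ≤ n) :
      Exec B (.block [.add 2 2 1, .add 2 2 1, .sub 5 5 3]) (σ j) (σ (j + 1)) 0 := by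
    refine .of_eval_eq (Program.straight_block.2 (by simp [Program.Straight])) (hσ j hj) ?_
    have hadd : 2 * (j * d) + d + d = 2 * ((j + 1) * d) := by ring
    simp [σ, Nat.sub_sub, hadd]
  have hend : Exec B (.block [.add 6 2 13, .add 7 2 13, .add 9 2 13]) (σ n)
      ((tableReader u v).state ⟨[], [], []⟩ .empty 0 0 0 0) 0 := by
    refine .of_eval_eq (Program.straight_block.2 (by simp [Program.Straight])) (hσ n le_rfl) ?_
    simp [σ, Reader.state, tableReader, Tally.empty, Queue.nodes, layout_input]
  have hloop := Exec.loop (σ := σ) (i := 5) (m := n) (by simp [σ]) fun j hj =>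
    ⟨by simpa [σ] using Nat.sub_ne_zero_of_lt hj, (hσ j hj.le).1 5, hstep j hj.le⟩
  exact (hstart.seq (hloop.seq hend)).mono (by omega)

end Setup

/-- Words of `B` bits suffice for a factorization with parameters `κ`, `K` and `L` that is applied
to the `D` blocks of vectors of length `d`. -/
structure WordSize (n d κ K L D B : ℕ) : Prop where
  blocks_le_iff : ∀ j, D ≤ j ↔ d ≤ j * κ
  sparsity_pos : 0 < L
  pos : 0 < B
  n_lt : n < 2 ^ B
  d_lt : d < 2 ^ B
  key_le : ∀ j ≤ D, K ^ j ≤ 2 ^ B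
  space_lt : 2 * (n * d) + 3 * (2 * (n * ((D + 1) * L ^ D))) < 2 ^ B
  sq_lt : n * L ^ D * (n * L ^ D) < 2 ^ B

section Tables

variable {n d κ K L D B : ℕ} {F : (Fin κ → Bool) → List SignedKey}

theorem length_tableLeaves_le (hF : ∀ x, (F x).length ≤ L) (x : ℕ → ℕ → Bool) :
    (tableLeaves K F x D n).length ≤ n * L ^ D :=
  length_flatMap_range_le fun i _ => length_leaves_le hF (x i) D

theorem length_leaves_le_of_le (hL : 0 < L) (hF : ∀ x, (F x).length ≤ L) (x : ℕ → Bool) {j : ℕ}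
    (hj : j ≤ D) : (leaves K F x j).length ≤ L ^ D :=
  (length_leaves_le hF x j).trans (Nat.pow_le_pow_right hL hj)

theorem length_tableLevels_le (hL : 0 < L) (hF : ∀ x, (F x).length ≤ L) (x : ℕ → ℕ → Bool) :
    (tableLevels K F x D n).length ≤ n * ((D + 1) * L ^ D) :=
  length_flatMap_range_le fun i _ => length_flatMap_range_le fun _ hj =>
    length_leaves_le_of_le hL hF (x i) (Nat.lt_succ_iff.1 hj)

namespace WordSize

variable (h : WordSize n d κ K L D B)
include h

theorem tableLevels_lt (hF : ∀ x, ∀ k ∈ F x, k.1 < K) (x : ℕ → ℕ → Bool) :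
    ∀ a ∈ tableLevels K F x D n, a.1 < 2 ^ B := by
  simp only [tableLevels, levels, List.mem_flatMap, List.mem_range]
  rintro a ⟨i, -, j, hj, ha⟩
  exact (leaves_lt hF (x i) j a ha).trans_le (h.key_le j (Nat.lt_succ_iff.1 hj))

theorem fits_queue (Φ : Factorization κ K L) (x y : ℕ → ℕ → Bool) :
    Queue.Fits ⟨tableLevels K Φ.left x D n ++ tableLevels K Φ.right y D n, [], []⟩ (2 * (n * d))
      B := by
  have hx := length_tableLevels_le (K := K) (D := D) (n := n) h.sparsity_pos Φ.length_left_le x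
  have hy := length_tableLevels_le (K := K) (D := D) (n := n) h.sparsity_pos Φ.length_right_le y
  have hspace := h.space_lt
  simp only [Queue.Fits, Queue.nodes, List.append_nil, List.length_append, List.mem_append]
  exact ⟨fun a ha => ha.elim (h.tableLevels_lt Φ.left_lt x a) (h.tableLevels_lt Φ.right_lt y a),
    by omega⟩

theorem length_lt {A : List SignedKey} (hA : A.length ≤ n * L ^ D) : A.length < 2 ^ B :=
  hA.trans_lt ((Nat.le_mul_self _).trans_lt h.sq_lt)

theorem fits_count {A : List SignedKey} (hA : A.length ≤ n * L ^ D) :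
    (A.foldl Tally.count .empty).Fits B :=
  fits_foldl_count (h.length_lt hA)

theorem fits_lookup {A A' : List SignedKey} (hA : A.length ≤ n * L ^ D)
    (hA' : A'.length ≤ n * L ^ D) :
    (A'.foldl Tally.lookup (A.foldl Tally.count .empty)).Fits B :=
  fits_foldl_lookup (h.length_lt hA) ((Nat.mul_le_mul hA' hA).trans_lt h.sq_lt)

theorem exec_readTable_left (Φ : Factorization κ K L) (u v : Fin n → Fin d → Bool) :
    Exec B (readTable κ K Φ.left countLeaf)
      ((tableReader u v).state ⟨[], [], []⟩ .empty 0 0 0 0)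
      (((tableReader u v).atRow n).state ⟨tableLevels K Φ.left (rowBits u) D n, [], []⟩
        ((tableLeaves K Φ.left (rowBits u) D n).foldl Tally.count .empty) 0 0 0 0)
      (n * ((D + 1) * (L ^ D + 1))) := by
  have hcursor : 0 + n * d ≤ 2 * (n * d) := by omega
  refine exec_readTable (P := []) nodeStep_countLeaf (fits_tableReader u v h.pos h.n_lt h.d_lt) rfl
    hcursor (fun j hj => reads_rowBits_left u v hj) h.blocks_le_iff
    (fun i j hj => length_leaves_le_of_le h.sparsity_pos Φ.length_left_le _ hj)
    ((h.fits_queue Φ (rowBits u) (rowBits v)).mono ?_)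
    fun C hC => h.fits_count (hC.length_le.trans (length_tableLeaves_le Φ.length_left_le _))
  simp only [Queue.nodes, List.append_nil]
  exact List.prefix_append _ _

theorem exec_readTable_right (Φ : Factorization κ K L) (u v : Fin n → Fin d → Bool)
    {A : List SignedKey} (hA : A.length ≤ n * L ^ D) :
    Exec B (readTable κ K Φ.right lookupLeaf)
      (((tableReader u v).atRow n).state ⟨tableLevels K Φ.left (rowBits u) D n, [], []⟩
        (A.foldl Tally.count .empty) 0 0 0 0)
      ((((tableReader u v).atRow n).atRow n).state
        ⟨tableLevels K Φ.left (rowBits u) D n ++ tableLevels K Φ.right (rowBits v) D n, [], []⟩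
        ((tableLeaves K Φ.right (rowBits v) D n).foldl Tally.lookup
          (A.foldl Tally.count .empty)) 0 0 0 0)
      (n * ((D + 1) * (L ^ D + 1))) := by
  have hcursor : 0 + n * d ≤ 2 * (n * d) := by omega
  have hcursor' : 0 + n * d + n * d ≤ 2 * (n * d) := by omega
  exact exec_readTable nodeStep_lookupLeaf
    ((fits_tableReader u v h.pos h.n_lt h.d_lt).atRow hcursor le_rfl) rfl hcursor'
    (fun j hj => reads_rowBits_right u v hj) h.blocks_le_iff
    (fun i j hj => length_leaves_le_of_le h.sparsity_pos Φ.length_right_le _ hj)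
    (h.fits_queue Φ (rowBits u) (rowBits v))
    fun C hC => h.fits_lookup hA (hC.length_le.trans (length_tableLeaves_le Φ.length_right_le _))

theorem exec_countProgram (Φ : Factorization κ K L) (u v : Fin n → Fin d → Bool) :
    ∃ s, s.reg 0 = count u v ∧ Exec B (countProgram κ K Φ.left Φ.right) (input u v) s
      (n + 2 * (n * ((D + 1) * (L ^ D + 1)))) := by
  let A := tableLeaves K Φ.left (rowBits u) D n
  let A' := tableLeaves K Φ.right (rowBits v) D n
  have hA : A.length ≤ n * L ^ D := length_tableLeaves_le Φ.length_left_le _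
  have hA' : A'.length ≤ n * L ^ D := length_tableLeaves_le Φ.length_right_le _
  have hbase := exec_setBase u v h.pos h.n_lt h.d_lt ((Nat.le_add_right _ _).trans_lt h.space_lt)
  have hcursor : 0 + n * d ≤ 2 * (n * d) := by omega
  have hcursor' : 0 + n * d + n * d ≤ 2 * (n * d) := by omega
  have hsub := (show (Program.block [.sub 0 14 15]).Straight from ⟨trivial, trivial⟩).exec
    (bounded_state (((fits_tableReader u v h.pos h.n_lt h.d_lt).atRow hcursor le_rfl).atRow hcursor'
      le_rfl) (h.fits_queue Φ (rowBits u) (rowBits v)) (h.fits_lookup hA hA')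
      (Nat.two_pow_pos B))
  refine ⟨_, ?_, (hbase.seq ((h.exec_readTable_left Φ u v).seq
    ((h.exec_readTable_right Φ u v hA).seq hsub))).mono (by omega)⟩
  have hcount := pos_sub_neg_eq_pairing A A'
  rw [← count_eq_pairing Φ ((h.blocks_le_iff D).1 le_rfl)] at hcount
  change (A'.foldl Tally.lookup (A.foldl Tally.count .empty)).pos -
    (A'.foldl Tally.lookup (A.foldl Tally.count .empty)).neg = count u v
  omega

end WordSize

end Tables

/-! ### Time -/

section Estimates

variable {n d κ K L : ℕ}

theorem ceilDiv_le_self (hκ : 0 < κ) : d ⌈/⌉ κ ≤ d :=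
  (ceilDiv_le_iff_le_mul hκ).2 (Nat.le_mul_of_pos_left d hκ)

theorem mul_ceilDiv_le (hκ : 0 < κ) : κ * (d ⌈/⌉ κ) ≤ κ + d := by
  rw [Nat.ceilDiv_eq_add_pred_div]
  exact (Nat.mul_div_le _ _).trans (by omega)

theorem pow_ceilDiv_le (hκ : 0 < κ) (hL : 0 < L) : L ^ (d ⌈/⌉ κ) ≤ 2 ^ (L * d) :=
  calc L ^ (d ⌈/⌉ κ) ≤ L ^ d := Nat.pow_le_pow_right hL (ceilDiv_le_self hκ)
    _ ≤ (2 ^ L) ^ d := Nat.pow_le_pow_left Nat.lt_two_pow_self.le d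
    _ = 2 ^ (L * d) := (pow_mul 2 L d).symm

theorem wordSize (n d K : ℕ) (hκ : 0 < κ) (hL : 0 < L) :
    WordSize n d κ K L (d ⌈/⌉ κ) (3 + 2 * n.size + (2 * L + K + 1) * d) := by
  have hn : n < 2 ^ n.size := Nat.lt_size_self n
  have hd : d < 2 ^ d := Nat.lt_two_pow_self
  have hD : d ⌈/⌉ κ ≤ d := ceilDiv_le_self hκ
  have hleaves : L ^ (d ⌈/⌉ κ) ≤ 2 ^ (L * d) := pow_ceilDiv_le hκ hL
  have hB : (2 * L + K + 1) * d = 2 * (L * d) + K * d + d := by ring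
  have hpow {m : ℕ} (hm : m ≤ 3 + 2 * n.size + (2 * (L * d) + K * d + d)) :
      2 ^ m ≤ 2 ^ (3 + 2 * n.size + (2 * L + K + 1) * d) :=
    Nat.pow_le_pow_right two_pos (hB ▸ hm)
  have hinput : n * d < 2 ^ (n.size + d + L * d) :=
    calc n * d < 2 ^ n.size * 2 ^ d := Nat.mul_lt_mul'' hn hd
      _ = 2 ^ (n.size + d) := (pow_add ..).symm
      _ ≤ 2 ^ (n.size + d + L * d) := Nat.pow_le_pow_right two_pos (Nat.le_add_right _ _)
  have hlevels : n * ((d ⌈/⌉ κ + 1) * L ^ (d ⌈/⌉ κ)) < 2 ^ (n.size + d + L * d) :=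
    calc n * ((d ⌈/⌉ κ + 1) * L ^ (d ⌈/⌉ κ)) < 2 ^ n.size * (2 ^ d * 2 ^ (L * d)) :=
          Nat.mul_lt_mul_of_lt_of_le hn (Nat.mul_le_mul (by omega) hleaves) (by positivity)
      _ = 2 ^ (n.size + d + L * d) := by ring
  have hleaf : n * L ^ (d ⌈/⌉ κ) < 2 ^ (n.size + L * d) := by
    rw [pow_add]
    exact Nat.mul_lt_mul_of_lt_of_le hn hleaves (by positivity)
  exact {
    blocks_le_iff j := by rw [ceilDiv_le_iff_le_mul hκ, mul_comm]
    sparsity_pos := hL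
    pos := by omega
    n_lt := hn.trans_le (hpow (by omega))
    d_lt := hd.trans_le (hpow (by omega))
    key_le j hj :=
      calc K ^ j ≤ (2 ^ K) ^ j := Nat.pow_le_pow_left Nat.lt_two_pow_self.le j
        _ = 2 ^ (K * j) := (pow_mul 2 K j).symm
        _ ≤ _ := hpow (by have := Nat.mul_le_mul_left K (hj.trans hD); omega)
    space_lt :=
      calc _ < 2 ^ 3 * 2 ^ (n.size + d + L * d) := by omega
        _ = 2 ^ (3 + (n.size + d + L * d)) := (pow_add ..).symm
        _ ≤ _ := hpow (by omega)
    sq_lt :=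
      calc _ < 2 ^ (n.size + L * d) * 2 ^ (n.size + L * d) := Nat.mul_self_lt_mul_self hleaf
        _ = 2 ^ (n.size + L * d + (n.size + L * d)) := (pow_add ..).symm
        _ ≤ _ := hpow (by omega) }

variable {β : ℝ}

theorem one_lt_of_two_lt_pow_three (hβ : 2 < β ^ 3) : 1 < β := by
  by_contra! h
  have := Odd.pow_le_pow (by decide : Odd 3) |>.2 h
  linarith

theorem one_fifth_le_log (hβ : 2 < β ^ 3) : 1 / 5 ≤ Real.log β := by
  have hlog := Real.log_lt_log two_pos hβ
  rw [Real.log_pow] at hlog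
  have := Real.log_two_gt_d9
  norm_num at hlog
  linarith

theorem size_le_log (hn : 1 ≤ n) : (n.size : ℝ) ≤ 1 + 2 * Real.log n := by
  obtain ⟨m, hm⟩ := Nat.exists_eq_add_one.2 (Nat.size_pos.2 hn)
  have hpow : (2 : ℝ) ^ m ≤ n := by
    exact_mod_cast Nat.lt_size.1 (by omega : m < n.size)
  have hlog := Real.log_le_log (by positivity) hpow
  rw [Real.log_pow] at hlog
  have := mul_le_mul_of_nonneg_left Real.log_two_gt_d9.le m.cast_nonneg
  rw [hm]
  push_cast
  linarith

theorem log_mul_pow (hβ : 0 < β) (hn : 1 ≤ n) :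
    Real.log (n * β ^ d) = Real.log n + d * Real.log β := by
  rw [Real.log_mul (by positivity) (by positivity), Real.log_pow]

theorem natSize_le_two_mul_log (hβ : 2 < β ^ 3) (hn : 1 ≤ n) :
    (n.size : ℝ) ≤ 2 * (1 + Real.log (n * β ^ d)) := by
  have hβ' := one_lt_of_two_lt_pow_three hβ
  have := size_le_log hn
  have := mul_nonneg (d.cast_nonneg) (Real.log_nonneg hβ'.le)
  rw [log_mul_pow (one_pos.trans hβ') hn]
  linarith

theorem natCast_le_five_mul_log (hβ : 2 < β ^ 3) (hn : 1 ≤ n) :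
    (d : ℝ) ≤ 5 * Real.log (n * β ^ d) := by
  have := mul_le_mul_of_nonneg_left (one_fifth_le_log hβ) d.cast_nonneg
  have := Real.log_natCast_nonneg n
  rw [log_mul_pow (one_pos.trans (one_lt_of_two_lt_pow_three hβ)) hn]
  linarith

theorem pow_ceilDiv_le_mul_pow (hβ : 1 ≤ β) (hκ : 0 < κ) (hL : (L : ℝ) ≤ β ^ κ) :
    (L : ℝ) ^ (d ⌈/⌉ κ) ≤ β ^ κ * β ^ d :=
  calc (L : ℝ) ^ (d ⌈/⌉ κ) ≤ (β ^ κ) ^ (d ⌈/⌉ κ) := by gcongr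
    _ = β ^ (κ * (d ⌈/⌉ κ)) := (pow_mul ..).symm
    _ ≤ β ^ (κ + d) := pow_le_pow_right₀ hβ (mul_ceilDiv_le hκ)
    _ = β ^ κ * β ^ d := pow_add ..

theorem passes_le {D M : ℕ} (hn : 1 ≤ n) (hM : 1 ≤ M) :
    n + 2 * (n * ((D + 1) * (M + 1))) + 1 ≤ 6 * (n * ((D + 1) * M)) := by
  have hnM : n ≤ n * ((D + 1) * M) := Nat.le_mul_of_pos_right n (by positivity)
  have hsucc : n * ((D + 1) * (M + 1)) ≤ 2 * (n * ((D + 1) * M)) :=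
    calc n * ((D + 1) * (M + 1)) ≤ n * ((D + 1) * (2 * M)) := by gcongr; omega
      _ = 2 * (n * ((D + 1) * M)) := by ring
  omega

theorem passes_le_mul_log (hβ : 2 < β ^ 3) (hκ : 0 < κ) (hL : 0 < L) (hLβ : (L : ℝ) ≤ β ^ κ)
    (hn : 1 ≤ n) :
    ((n + 2 * (n * ((d ⌈/⌉ κ + 1) * (L ^ (d ⌈/⌉ κ) + 1))) + 1 : ℕ) : ℝ) ≤
      36 * β ^ κ * (n * β ^ d) * (1 + Real.log (n * β ^ d)) := by
  have hβ' := one_lt_of_two_lt_pow_three hβ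
  have hblocks : ((d ⌈/⌉ κ : ℕ) : ℝ) + 1 ≤ 6 * (1 + Real.log (n * β ^ d)) := by
    have hD : ((d ⌈/⌉ κ : ℕ) : ℝ) ≤ d := by exact_mod_cast ceilDiv_le_self hκ
    have := natCast_le_five_mul_log (d := d) hβ hn
    have := (Nat.cast_nonneg (α := ℝ) d)
    linarith
  calc ((n + 2 * (n * ((d ⌈/⌉ κ + 1) * (L ^ (d ⌈/⌉ κ) + 1))) + 1 : ℕ) : ℝ)
      ≤ (6 * (n * ((d ⌈/⌉ κ + 1) * L ^ (d ⌈/⌉ κ))) : ℕ) :=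
        Nat.cast_le.2 (passes_le hn (Nat.pow_pos hL))
    _ = 6 * (n * ((((d ⌈/⌉ κ : ℕ) : ℝ) + 1) * (L : ℝ) ^ (d ⌈/⌉ κ))) := by push_cast; ring
    _ ≤ 6 * (n * (6 * (1 + Real.log (n * β ^ d)) * (β ^ κ * β ^ d))) := by
        gcongr
        · exact (by positivity : (0 : ℝ) ≤ _).trans hblocks
        · exact pow_ceilDiv_le_mul_pow hβ'.le hκ hLβ
    _ = _ := by ring

theorem wordSize_le_mul_log (hβ : 2 < β ^ 3) (hn : 1 ≤ n) (w : ℕ) :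
    ((2 * (3 + 2 * n.size + (2 * L + K + 1) * d + w) + 1 : ℕ) : ℝ) ≤
      (15 + 10 * (2 * L + K + 1) + 2 * w) * (1 + Real.log (n * β ^ d)) := by
  have hsize := natSize_le_two_mul_log (d := d) hβ hn
  have hdim := natCast_le_five_mul_log (d := d) hβ hn
  calc ((2 * (3 + 2 * n.size + (2 * L + K + 1) * d + w) + 1 : ℕ) : ℝ)
      = 7 + 2 * w + 4 * n.size + 2 * (2 * L + K + 1) * d := by push_cast; ring
    _ ≤ (7 + 2 * w) * (1 + Real.log (n * β ^ d)) + 4 * (2 * (1 + Real.log (n * β ^ d))) +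
        2 * (2 * L + K + 1) * (5 * (1 + Real.log (n * β ^ d))) := by
      gcongr
      · exact le_mul_of_one_le_right (by positivity) (by linarith)
      · linarith
    _ = _ := by ring

theorem time_le_mul_log_sq (hβ : 2 < β ^ 3) (hκ : 0 < κ) (hL : 0 < L) (hLβ : (L : ℝ) ≤ β ^ κ)
    (hn : 1 ≤ n) (w : ℕ) :
    ((w * (n + 2 * (n * ((d ⌈/⌉ κ + 1) * (L ^ (d ⌈/⌉ κ) + 1))) + 1) *
      (2 * (3 + 2 * n.size + (2 * L + K + 1) * d + w) + 1) : ℕ) : ℝ) ≤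
      w * (36 * β ^ κ) * (15 + 10 * (2 * L + K + 1) + 2 * w) * (n * β ^ d) *
        (1 + Real.log (n * β ^ d)) ^ 2 := by
  have hpasses := passes_le_mul_log (d := d) hβ hκ hL hLβ hn
  have hword := wordSize_le_mul_log (d := d) (K := K) (L := L) hβ hn w
  rw [mul_assoc, Nat.cast_mul, Nat.cast_mul]
  calc _ ≤ (w : ℝ) * ((36 * β ^ κ * (n * β ^ d) * (1 + Real.log (n * β ^ d))) *
        ((15 + 10 * (2 * L + K + 1) + 2 * w) * (1 + Real.log (n * β ^ d)))) :=
        mul_le_mul_of_nonneg_left (mul_le_mul hpasses hword (Nat.cast_nonneg _)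
          ((Nat.cast_nonneg _).trans hpasses)) w.cast_nonneg
    _ = _ := by ring

end Estimates

end OrthogonalVectors

theorem mainTheorem7_general {β : ℝ} (hβ : 2 < β ^ 3) :
    ∃ (P : RAM.Program) (C k : ℕ),
      ∀ (n d : ℕ), 1 ≤ n → ∀ u v : Fin n → Fin d → Bool,
        ∃ (s : RAM.State) (t : ℕ),
          RAM.Runs P (OrthogonalVectors.input u v) s t ∧
          s.reg 0 = OrthogonalVectors.count u v ∧
          (t : ℝ) ≤ C * (n * β ^ d) * (1 + Real.log (n * β ^ d)) ^ k := by
  obtain ⟨κ, K, L, hκ, hL, hLβ, ⟨Φ⟩⟩ := OrthogonalVectors.exists_factorization hβ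
  let P := OrthogonalVectors.countProgram κ K Φ.left Φ.right
  let c : ℝ := P.weight * (36 * β ^ κ) * (15 + 10 * (2 * L + K + 1) + 2 * P.weight)
  refine ⟨P, ⌈c⌉₊, 2, fun n d hn u v => ?_⟩
  obtain ⟨s, hcount, t, hrun, ht⟩ :=
    (OrthogonalVectors.wordSize n d K hκ hL).exec_countProgram Φ u v
  have hβ₀ : 0 < β := one_pos.trans (OrthogonalVectors.one_lt_of_two_lt_pow_three hβ)
  refine ⟨s, t, hrun, hcount, ?_⟩
  calc (t : ℝ) ≤ c * (n * β ^ d) * (1 + Real.log (n * β ^ d)) ^ 2 :=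
        (Nat.cast_le.2 ht).trans
          (OrthogonalVectors.time_le_mul_log_sq hβ hκ hL hLβ hn P.weight)
    _ ≤ ⌈c⌉₊ * (n * β ^ d) * (1 + Real.log (n * β ^ d)) ^ 2 := by
        gcongr
        exact Nat.le_ceil c

theorem mainTheorem7 :
    ∃ (P : RAM.Program) (C k : ℕ),
      ∀ (n d : ℕ), 1 ≤ n → ∀ u v : Fin n → Fin d → Bool,
        ∃ (s : RAM.State) (t : ℕ),
          RAM.Runs P (OrthogonalVectors.input u v) s t ∧
          s.reg 0 = OrthogonalVectors.count u v ∧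
          (t : ℝ) ≤ C * (n * (1.26 : ℝ) ^ d) * (1 + Real.log (n * (1.26 : ℝ) ^ d)) ^ k :=
  mainTheorem7_general (by norm_num)
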